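/- **Setting.** There are $n\ge 1$ machines and an unknown vector $\nabla\in\mathbb R^d$, $d\ge 1$. Machine $v$ holds a random vector $x_v\in\mathbb R^d$; the $x_v$ are independent, $\mathbb E[x_v]=\nabla$ and $\mathbb E\|x_v-\nabla\|_2^2\le\sigma^2$, where $\sigma>0$ is known to all machines. The machines share randomness that is independent of the inputs. All norms are $\ell_2$ norms. **Lattices.** For a lattice $\Lambda\subset\mathbb R^d$ with basis $b_1,\dots,b_d$, let $r_p$ be its packing radius (the supremum of the $r$ for which the radius-$r$ balls around distinct lattice points are disjoint) and $r_c$ its cover radius (the infimum of the $r$ for which the radius-$r$ balls around lattice points cover $\mathbb R^d$). $\Lambda$ is an $\varepsilon$-lattice if $\varepsilon=r_p\le r_c\le 3\varepsilon$. For $\lambda\in\Lambda$ let $\mathrm{Vor}(\lambda)$ be its open Voronoi region and $\mathrm{Vor}^+(\lambda)$ the set of points within distance $2q\varepsilon$ of $\mathrm{Vor}(\lambda)$. **Algorithm** (parameters $q>0$, $\alpha>1$). Put $\varepsilon=2\sigma\sqrt{\alpha n}/q$ and fix an $\varepsilon$-lattice $\Lambda$ with a basis. Let $c$ be the map that reduces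 the basis coordinates of a lattice point modulo $\lceil 3+2q\rceil$. A source machine $u$ is chosen uniformly at random. For $i=0,1,2,\dots$ the shared randomness supplies independent pairs $(\theta_i,\hat c_i)$, where $\theta_i$ is uniform in $\mathrm{Vor}(0)$ and $\hat c_i$ is an independent uniformly random map from $(\mathbb Z/\lceil 3+2q\rceil)^d$ to a set of $\lceil(1+2q)^{3d}\rceil$ colors. Let $z_i$ be a lattice point closest to $x_u+\theta_i$. The source takes the first $i$ for which no lattice point $z'\ne z_i$ has both $x_u+\theta_i\in \mathrm{Vor}^+(z')$ and $\hat c_i(c(z'))=\hat c_i(c(z_i))$. It broadcasts the message consisting of the color $\hat c_i(c(z_i))$, in a fixed number of bits, and $i$ in binary, along a binary tree rooted at $u$. Each machine $v$ (also $u$) looks for $\hat z\in\Lambda$ of the received color such that the closed ball of radius $q\varepsilon$ around $x_v+\theta_i$ meets $\mathrm{Vor}(\hat z)$, and outputs $\hat z-\theta_i$ (an arbitrary fixed value if there is no such $\hat z$). **Theorem.** For every $Q>0$ there are constants $C,c>0$, depending only on $Q$, such that for all $n,d\ge1$, $\alpha>1$, $\sigma>0$ and $0<q\le Q$ the following holds.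 An $\varepsilon$-lattice in $\mathbb R^d$ exists for $\varepsilon=2\sigma\sqrt{\alpha n}/q$, and for every choice of it, with a basis, and all inputs as above: 1. the algorithm terminates almost surely; 2. with probability at least $1-2^{(1-dq)\,2^{c\,dq}}$, every machine sends and receives at most $C\,dq$ bits in total; 3. the output $\mathrm{EST}$ of the source machine satisfies $\mathbb E[\mathrm{EST}]=\nabla$ and $\mathbb E\|\mathrm{EST}-\nabla\|_2^2\le C\,\alpha n\sigma^2/q^2$; 4. with probability at least $1-\frac1\alpha$, all machines output the same value $\mathrm{EST}$. -/

import Mathlib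

open MeasureTheory ProbabilityTheory

noncomputable section

namespace SublinearVR

/-- `d`-dimensional real space with the `ℓ₂` norm. -/
abbrev Vec (d : ℕ) := EuclideanSpace ℝ (Fin d)

/-! ### Lattices -/

/-- The lattice of all integer combinations of the basis vectors of `B`. -/
def lattice {d : ℕ} (B : Module.Basis (Fin d) ℝ (Vec d)) : Set (Vec d) :=
  (Submodule.span ℤ (Set.range B) : Set (Vec d))

/-- The supremum of the radii `r` for which the balls of radius `r` around distinct points of `L`
are disjoint. -/
def packingRadius {d : ℕ} (L : Set (Vec d)) : ℝ :=
  sSup {r : ℝ | ∀ a ∈ L, ∀ b ∈ L, a ≠ b → Disjoint (Metric.ball a r) (Metric.ball b r)}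

/-- The infimum of the radii `r` for which the balls of radius `r` around the points of `L`
cover the space. -/
def coverRadius {d : ℕ} (L : Set (Vec d)) : ℝ :=
  sInf {r : ℝ | ⋃ a ∈ L, Metric.closedBall a r = Set.univ}

/-- The lattice with basis `B` is an `ε`-lattice: `ε = r_p ≤ r_c ≤ 3 ε`. -/
def IsEpsLattice {d : ℕ} (B : Module.Basis (Fin d) ℝ (Vec d)) (ε : ℝ) : Prop :=
  packingRadius (lattice B) = ε ∧ ε ≤ coverRadius (lattice B) ∧ coverRadius (lattice B) ≤ 3 * ε

/-- The (open) Voronoi region of `a`. -/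
def voronoi {d : ℕ} (B : Module.Basis (Fin d) ℝ (Vec d)) (a : Vec d) : Set (Vec d) :=
  {x | ∀ b ∈ lattice B, b ≠ a → ‖x - a‖ < ‖x - b‖}

/-- The expanded Voronoi region of `a`: points within distance `2 q ε` of its Voronoi region. -/
def voronoiExp {d : ℕ} (B : Module.Basis (Fin d) ℝ (Vec d)) (ε q : ℝ) (a : Vec d) :
    Set (Vec d) :=
  {x | ∃ v ∈ voronoi B a, ‖x - v‖ ≤ 2 * q * ε}

open Classical in
/-- A lattice point closest to `p` (ties are broken arbitrarily). -/
def closestPoint {d : ℕ} (B : Module.Basis (Fin d) ℝ (Vec d)) (p : Vec d) : Vec d :=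
  if h : ∃ z ∈ lattice B, ∀ b ∈ lattice B, ‖p - z‖ ≤ ‖p - b‖ then h.choose else 0

/-! ### Random colorings -/

/-- The modulus `3 + 2 q` (rounded up) of the initial deterministic coloring. -/
def modulus (q : ℝ) : ℕ := ⌈3 + 2 * q⌉₊

/-- The number `(1 + 2 q) ^ (3 d)` (rounded up) of final colors. -/
def numColors (d : ℕ) (q : ℝ) : ℕ := ⌈(1 + 2 * q) ^ (3 * d)⌉₊

/-- The deterministic coloring: coordinates in the lattice basis, modulo `modulus q`. -/
def baseColor {d : ℕ} (B : Module.Basis (Fin d) ℝ (Vec d)) (q : ℝ) (z : Vec d) :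
    Fin d → ZMod (modulus q) :=
  fun j => ((⌊B.repr z j⌋ : ℤ) : ZMod (modulus q))

/-- The shared randomness of one iteration of the encoder: the offset `θ` and the map `ĉ` from
initial colors to final colors. -/
abbrev Trial (d : ℕ) (q : ℝ) :=
  Vec d × ((Fin d → ZMod (modulus q)) → Fin (numColors d q))

/-- In each iteration `θ` is uniform in the Voronoi region of the origin, and `ĉ` is an
independent uniformly random map. -/
def trialMeasure {d : ℕ} (B : Module.Basis (Fin d) ℝ (Vec d)) (q : ℝ) : Measure (Trial d q) :=
  (ProbabilityTheory.cond volume (voronoi B 0)).prod (uniformOn Set.univ)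

/-- The final color `ĉ (c z)` of a lattice point. -/
def color {d : ℕ} (B : Module.Basis (Fin d) ℝ (Vec d)) (q : ℝ) (t : Trial d q) (z : Vec d) :
    Fin (numColors d q) :=
  t.2 (baseColor B q z)

/-! ### Encoding -/

/-- The lattice point to which the input `x` is rounded under the trial `t`. -/
def rounded {d : ℕ} {q : ℝ} (B : Module.Basis (Fin d) ℝ (Vec d)) (t : Trial d q) (x : Vec d) :
    Vec d :=
  closestPoint B (x + t.1)

/-- The trial `t` is successful for the input `x`: no other lattice point whose expanded Voronoi
region contains `x + θ` has the same color as the rounded point. -/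
def Successful {d : ℕ} (B : Module.Basis (Fin d) ℝ (Vec d)) (ε q : ℝ) (t : Trial d q)
    (x : Vec d) : Prop :=
  ¬ ∃ b ∈ lattice B, b ≠ rounded B t x ∧ x + t.1 ∈ voronoiExp B ε q b ∧
    color B q t (rounded B t x) = color B q t b

/-- The index of the iteration in which the encoder terminates. -/
def stopIndex {d : ℕ} (B : Module.Basis (Fin d) ℝ (Vec d)) (ε q : ℝ) (t : ℕ → Trial d q)
    (x : Vec d) : ℕ :=
  sInf {i | Successful B ε q (t i) x}

/-- The number of bits used to write a color. -/
def colorWidth (d : ℕ) (q : ℝ) : ℕ := Nat.clog 2 (numColors d q)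

/-- The color in `colorWidth` bits, followed by the binary representation of the iteration index
(least significant bits first). -/
def bitString (w c i : ℕ) : List Bool :=
  List.ofFn (fun j : Fin w => c.testBit j) ++ i.bits

/-- The number with the given binary representation, least significant bit first. -/
def bitsToNat (l : List Bool) : ℕ := l.foldr Nat.bit 0

/-- The message sent for the input `x`: the color of the rounded point and the iteration index. -/
def encode {d : ℕ} (B : Module.Basis (Fin d) ℝ (Vec d)) (ε q : ℝ) (t : ℕ → Trial d q)
    (x : Vec d) : List Bool :=
  let i := stopIndex B ε q t x
  bitString (colorWidth d q) (color B q (t i) (rounded B (t i) x)) i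

/-! ### Decoding -/

open Classical in
/-- Decode the message `m` using the shared randomness and the decoder's own input `xv`: read the
iteration index, look for a lattice point of the received color whose Voronoi region meets the
ball of radius `q ε` around `xv + θ`, and subtract `θ` from it. -/
def decode {d : ℕ} (B : Module.Basis (Fin d) ℝ (Vec d)) (ε q : ℝ) (t : ℕ → Trial d q)
    (m : List Bool) (xv : Vec d) : Vec d :=
  let s := t (bitsToNat (m.drop (colorWidth d q)))
  if h : ∃ z ∈ lattice B, (Metric.closedBall (xv + s.1) (q * ε) ∩ voronoi B z).Nonempty ∧
      (color B q s z : ℕ) = bitsToNat (m.take (colorWidth d q))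
  then h.choose - s.1 else 0

/-! ### The distributed algorithm -/

/-- The randomness of the algorithm: the source machine and the shared random trials. -/
abbrev Coins (n d : ℕ) (q : ℝ) := Fin n × (ℕ → Trial d q)

/-- The source is uniform, the trials are independent and identically distributed, and the source
is independent of the trials. -/
def coinMeasure (n : ℕ) {d : ℕ} (B : Module.Basis (Fin d) ℝ (Vec d)) (q : ℝ) :
    Measure (Coins n d q) :=
  (uniformOn Set.univ).prod (Measure.infinitePi fun _ : ℕ => trialMeasure B q)

/-- The loop of the source's encoder terminates. -/
def Terminates {n d : ℕ} (B : Module.Basis (Fin d) ℝ (Vec d)) (ε q : ℝ) (x : Fin n → Vec d)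
    (r : Coins n d q) : Prop :=
  ∃ i, Successful B ε q (r.2 i) (x r.1)

/-- The message broadcast by the source. -/
def message {n d : ℕ} (B : Module.Basis (Fin d) ℝ (Vec d)) (ε q : ℝ) (x : Fin n → Vec d)
    (r : Coins n d q) : List Bool :=
  encode B ε q r.2 (x r.1)

/-- The output of machine `v`. -/
def output {n d : ℕ} (B : Module.Basis (Fin d) ℝ (Vec d)) (ε q : ℝ) (x : Fin n → Vec d)
    (r : Coins n d q) (v : Fin n) : Vec d :=
  decode B ε q r.2 (message B ε q x r) (x v)

/-- The position of machine `v` in the broadcast tree rooted at the source `u`; the source has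
position `0`, and the parent of position `k + 1` is position `k / 2`. -/
def treePos {n : ℕ} (u v : Fin n) : ℕ := (v + n - u : ℕ) % n

/-- In the broadcast from `u` along the binary tree, `v` forwards the message to `w`. -/
def Forwards {n : ℕ} (u v w : Fin n) : Prop :=
  treePos u w ≠ 0 ∧ treePos u v = (treePos u w - 1) / 2

/-- The number of bits sent and received by machine `v`. -/
def bitsUsed {n d : ℕ} (B : Module.Basis (Fin d) ℝ (Vec d)) (ε q : ℝ) (x : Fin n → Vec d)
    (r : Coins n d q) (v : Fin n) : ℕ :=
  ({w | Forwards r.1 v w}.ncard + {w | Forwards r.1 w v}.ncard) * (message B ε q x r).length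

end SublinearVR

end

namespace SublinearVR

section Lattice

variable {d : ℕ} {B : Module.Basis (Fin d) ℝ (Vec d)} {ε : ℝ} {a b : Vec d}

lemma zero_mem_lattice (B : Module.Basis (Fin d) ℝ (Vec d)) : (0 : Vec d) ∈ lattice B :=
  Submodule.zero_mem _

lemma add_mem_lattice (ha : a ∈ lattice B) (hb : b ∈ lattice B) : a + b ∈ lattice B :=
  Submodule.add_mem _ ha hb

lemma neg_mem_lattice (ha : a ∈ lattice B) : -a ∈ lattice B :=
  Submodule.neg_mem _ ha

lemma sub_mem_lattice (ha : a ∈ lattice B) (hb : b ∈ lattice B) : a - b ∈ lattice B :=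
  Submodule.sub_mem _ ha hb

lemma countable_lattice (B : Module.Basis (Fin d) ℝ (Vec d)) : (lattice B).Countable :=
  Set.countable_coe_iff.1 (inferInstanceAs (Countable (Submodule.span ℤ (Set.range B))))

/-- Distinct points of an `ε`-lattice are at distance at least `2 ε`. -/
lemma IsEpsLattice.two_mul_le_norm_sub (hB : IsEpsLattice B ε)
    (ha : a ∈ lattice B) (hb : b ∈ lattice B) (hab : a ≠ b) : 2 * ε ≤ ‖a - b‖ := by
  by_contra! h
  have hlt : ‖a - b‖ / 2 < packingRadius (lattice B) := by rw [hB.1]; linarith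
  have hne : {r : ℝ | ∀ a ∈ lattice B, ∀ b ∈ lattice B, a ≠ b →
      Disjoint (Metric.ball a r) (Metric.ball b r)}.Nonempty :=
    ⟨0, by simp⟩
  obtain ⟨r, hr, hlr⟩ := exists_lt_of_lt_csSup hne hlt
  refine Set.disjoint_left.1 (hr a ha b hb hab) (?_ : midpoint ℝ a b ∈ _) ?_
  · rw [Metric.mem_ball, dist_midpoint_left, dist_eq_norm]
    norm_num; linarith
  · rw [Metric.mem_ball, dist_midpoint_right, dist_eq_norm]
    norm_num; linarith

lemma IsEpsLattice.isClosed (hB : IsEpsLattice B ε) (hε : 0 < ε) {s : Set (Vec d)}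
    (hs : s ⊆ lattice B) : IsClosed s :=
  Metric.isClosed_of_pairwise_le_dist (ε := 2 * ε) (by positivity) fun x hx y hy hxy => by
    simpa only [dist_eq_norm] using hB.two_mul_le_norm_sub (hs hx) (hs hy) hxy

lemma IsEpsLattice.exists_closest (hB : IsEpsLattice B ε) (hε : 0 < ε) (p : Vec d) :
    ∃ z ∈ lattice B, ∀ b ∈ lattice B, ‖p - z‖ ≤ ‖p - b‖ := by
  obtain ⟨z, hz, h⟩ := (hB.isClosed hε subset_rfl).exists_infDist_eq_dist
    ⟨0, zero_mem_lattice B⟩ p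
  refine ⟨z, hz, fun b hb => ?_⟩
  rw [← dist_eq_norm, ← dist_eq_norm, ← h]
  exact Metric.infDist_le_dist_of_mem hb

lemma IsEpsLattice.closestPoint_mem (hB : IsEpsLattice B ε) (hε : 0 < ε) (p : Vec d) :
    closestPoint B p ∈ lattice B := by
  rw [closestPoint, dif_pos (hB.exists_closest hε p)]
  exact (hB.exists_closest hε p).choose_spec.1

lemma IsEpsLattice.norm_sub_closestPoint_le (hB : IsEpsLattice B ε) (hε : 0 < ε) (p : Vec d)
    (hb : b ∈ lattice B) : ‖p - closestPoint B p‖ ≤ ‖p - b‖ := by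
  rw [closestPoint, dif_pos (hB.exists_closest hε p)]
  exact (hB.exists_closest hε p).choose_spec.2 b hb

/-- Every point is within `3 ε` of the lattice. -/
lemma IsEpsLattice.norm_sub_closestPoint_le_three (hB : IsEpsLattice B ε) (hε : 0 < ε)
    (p : Vec d) : ‖p - closestPoint B p‖ ≤ 3 * ε := by
  have hne : {r : ℝ | ⋃ a ∈ lattice B, Metric.closedBall a r = Set.univ}.Nonempty := by
    by_contra h
    rw [Set.not_nonempty_iff_eq_empty] at h
    have := hB.2.1
    rw [coverRadius, h, Real.sInf_empty] at this
    linarith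
  refine le_of_forall_gt fun r hr => ?_
  obtain ⟨s, hs, hsr⟩ := exists_lt_of_csInf_lt hne (lt_of_le_of_lt hB.2.2 hr)
  have hp : p ∈ ⋃ a ∈ lattice B, Metric.closedBall a s := by
    rw [show ⋃ a ∈ lattice B, Metric.closedBall a s = Set.univ from hs]; trivial
  obtain ⟨a, ha, hpa⟩ := Set.mem_iUnion₂.1 hp
  rw [Metric.mem_closedBall, dist_eq_norm] at hpa
  exact ((hB.norm_sub_closestPoint_le hε p ha).trans hpa).trans_lt hsr

/-- A point of the Voronoi region of `a` has `a` as its closest lattice point. -/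
lemma IsEpsLattice.closestPoint_eq (hB : IsEpsLattice B ε) (hε : 0 < ε) {y : Vec d}
    (ha : a ∈ lattice B) (hy : y ∈ voronoi B a) : closestPoint B y = a := by
  by_contra h
  exact absurd (hB.norm_sub_closestPoint_le hε y ha)
    (not_le.2 (hy _ (hB.closestPoint_mem hε y) h))

end Lattice

section Existence

variable {d : ℕ}

/-- The cubic lattice with side `2 ε`, as a basis. -/
noncomputable def cubicBasis (d : ℕ) {ε : ℝ} (hε : 0 < ε) : Module.Basis (Fin d) ℝ (Vec d) :=
  (EuclideanSpace.basisFun (Fin d) ℝ).toBasis.isUnitSMul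
    (w := fun _ => 2 * ε) fun _ => (by positivity : 2 * ε ≠ 0).isUnit

lemma cubicBasis_apply {ε : ℝ} (hε : 0 < ε) (i : Fin d) :
    cubicBasis d hε i = (2 * ε) • EuclideanSpace.single i (1 : ℝ) := by
  simp [cubicBasis, Module.Basis.isUnitSMul_apply]

lemma two_mul_le_norm_of_mem_cubic {ε : ℝ} (hε : 0 < ε) {x : Vec d}
    (hx : x ∈ Submodule.span ℤ (Set.range (cubicBasis d hε))) (h0 : x ≠ 0) : 2 * ε ≤ ‖x‖ := by
  have key : ∀ i, ∃ k : ℤ, x i = 2 * ε * k := by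
    clear h0
    induction hx using Submodule.span_induction with
    | mem x hx =>
      obtain ⟨j, rfl⟩ := hx
      intro i
      refine ⟨if i = j then 1 else 0, ?_⟩
      rw [cubicBasis_apply]
      by_cases h : i = j <;> simp [h]
    | zero => exact fun i => ⟨0, by simp⟩
    | add x y _ _ hx hy =>
      intro i
      obtain ⟨k, hk⟩ := hx i
      obtain ⟨l, hl⟩ := hy i
      exact ⟨k + l, by simp [hk, hl, mul_add]⟩
    | smul k x _ hx =>
      intro i
      obtain ⟨l, hl⟩ := hx i
      exact ⟨k * l, by simp [hl]; ring⟩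
  obtain ⟨i, hi⟩ : ∃ i, x i ≠ 0 := by
    by_contra! h
    exact h0 (by ext i; simpa using h i)
  obtain ⟨k, hk⟩ := key i
  have hk0 : k ≠ 0 := by rintro rfl; simp [hk] at hi
  have h1 : (1 : ℝ) ≤ |(k : ℝ)| := by exact_mod_cast Int.one_le_abs hk0
  calc 2 * ε ≤ 2 * ε * |(k : ℝ)| := le_mul_of_one_le_right (by positivity) h1
    _ = ‖x i‖ := by rw [hk, Real.norm_eq_abs, abs_mul, abs_of_pos (by positivity : 0 < 2 * ε)]
    _ ≤ ‖x‖ := PiLp.norm_apply_le x i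

/-- A maximal subgroup among those that contain the cubic lattice and whose nonzero elements have
norm at least `2 ε`. -/
lemma exists_maximal_separated {ε : ℝ} (hε : 0 < ε) :
    ∃ L : Submodule ℤ (Vec d), Submodule.span ℤ (Set.range (cubicBasis d hε)) ≤ L ∧
      Maximal (fun M : Submodule ℤ (Vec d) => ∀ x ∈ M, x ≠ 0 → 2 * ε ≤ ‖x‖) L := by
  refine zorn_le_nonempty₀ {M : Submodule ℤ (Vec d) | ∀ x ∈ M, x ≠ 0 → 2 * ε ≤ ‖x‖}
    (fun c hc hchain y hy => ⟨sSup c, ?_, fun z hz => le_sSup hz⟩) _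
    (fun x hx h0 => two_mul_le_norm_of_mem_cubic hε hx h0)
  intro x hx h0
  obtain ⟨M, hM, hxM⟩ := (Submodule.mem_sSup_of_directed ⟨y, hy⟩ hchain.directedOn).1 hx
  exact hc hM x hxM h0

/-- A maximal separated subgroup covers space with radius `3 ε`: otherwise a third of a lattice
point close to a deep hole could be added. -/
lemma infDist_le_of_maximal {ε : ℝ} (hε : 0 < ε) {L : Submodule ℤ (Vec d)}
    (hle : Submodule.span ℤ (Set.range (cubicBasis d hε)) ≤ L)
    (hL : Maximal (fun M : Submodule ℤ (Vec d) => ∀ x ∈ M, x ≠ 0 → 2 * ε ≤ ‖x‖) L) (p : Vec d) :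
    Metric.infDist p L ≤ 3 * ε := by
  have hne : (L : Set (Vec d)).Nonempty := ⟨0, L.zero_mem⟩
  have hbdd : BddAbove (Set.range fun y : Vec d => Metric.infDist y L) := by
    refine ⟨∑ i, ‖cubicBasis d hε i‖, ?_⟩
    rintro _ ⟨y, rfl⟩
    refine (Metric.infDist_le_dist_of_mem
      (hle (ZSpan.floor (cubicBasis d hε) y).2)).trans ?_
    rw [dist_eq_norm]
    exact ZSpan.norm_fract_le (cubicBasis d hε) y
  by_contra! h
  set R := ⨆ y : Vec d, Metric.infDist y L with hR
  have hpR : Metric.infDist p L ≤ R := le_ciSup hbdd p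
  have hR3 : 3 * ε < R := h.trans_le hpR
  obtain ⟨y, hy⟩ := exists_lt_of_lt_ciSup (show R - (R - 3 * ε) / 3 < R by linarith)
  -- a point of `L / 3` near `y`
  obtain ⟨l, hl, hly⟩ := (Metric.infDist_lt_iff hne (x := (3 : ℝ) • y)
    (r := R + (R - 3 * ε))).1 ((le_ciSup hbdd ((3 : ℝ) • y)).trans_lt (by linarith))
  set z : Vec d := (3 : ℝ)⁻¹ • l with hz
  have h3z : (3 : ℤ) • z = l := by
    rw [hz, ← Int.cast_smul_eq_zsmul ℝ, smul_smul]; norm_num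
  have hyz : dist y z ≤ (R + (R - 3 * ε)) / 3 := by
    have : dist ((3 : ℝ) • y) l = 3 * dist y z := by
      rw [← h3z, ← Int.cast_smul_eq_zsmul ℝ, Int.cast_ofNat, dist_smul₀]; norm_num
    linarith
  have hzL : 2 * ε ≤ Metric.infDist z L := by
    have := Metric.infDist_le_infDist_add_dist (s := (L : Set (Vec d))) (x := y) (y := z)
    linarith
  have hsep : ∀ m ∈ L, 2 * ε ≤ ‖z + m‖ := fun m hm => by
    have := Metric.infDist_le_dist_of_mem (x := z) (L.neg_mem hm)
    rw [dist_eq_norm, sub_neg_eq_add] at this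
    exact hzL.trans this
  have hmem : ∀ x ∈ L ⊔ Submodule.span ℤ {z}, x ≠ 0 → 2 * ε ≤ ‖x‖ := by
    intro x hx h0
    obtain ⟨m, hm, w, hw, rfl⟩ := Submodule.mem_sup.1 hx
    obtain ⟨k, rfl⟩ := Submodule.mem_span_singleton.1 hw
    have hq : ∀ j : ℤ, (3 * j) • z ∈ L := fun j => by
      rw [mul_comm, mul_smul, h3z]; exact L.smul_mem _ hl
    obtain ⟨j, hj | hj | hj⟩ : ∃ j : ℤ, k = 3 * j ∨ k = 3 * j + 1 ∨ k = 3 * j - 1 :=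
      ⟨(k + 1) / 3, by omega⟩
    · exact hL.prop _ (L.add_mem hm (hj ▸ hq j)) h0
    · have := hsep _ (L.add_mem hm (hq j))
      rwa [show m + k • z = z + (m + (3 * j) • z) by rw [hj, add_smul, one_smul]; abel]
    · have := hsep _ (L.neg_mem (L.add_mem hm (hq j)))
      rwa [← norm_neg, show -(m + k • z) = z + -(m + (3 * j) • z) by
        rw [hj, sub_smul, one_smul]; abel]
  have hzmem : z ∈ L := hL.le_of_ge hmem le_sup_left
    (Submodule.mem_sup_right (Submodule.mem_span_singleton_self z))
  rw [Metric.infDist_zero_of_mem hzmem] at hzL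
  linarith

/-- In every dimension there is a lattice with `r_p = ε` and `r_c ≤ 3 ε`. -/
theorem exists_isEpsLattice (hd : 1 ≤ d) {ε : ℝ} (hε : 0 < ε) :
    ∃ B : Module.Basis (Fin d) ℝ (Vec d), IsEpsLattice B ε := by
  obtain ⟨L, hle, hL⟩ := exists_maximal_separated (d := d) hε
  have hsep : ∀ x ∈ L, ∀ y ∈ L, x ≠ y → 2 * ε ≤ ‖x - y‖ := fun x hx y hy hxy =>
    hL.prop _ (L.sub_mem hx hy) (sub_ne_zero.2 hxy)
  have : DiscreteTopology L :=
    DiscreteTopology.of_forall_le_norm (r := 2 * ε) (by positivity) fun x hx =>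
      hL.prop _ x.2 (by simpa using hx)
  have : IsZLattice ℝ L := ⟨by
    refine eq_top_iff.2 ?_
    rw [← ZSpan.span_top (cubicBasis d hε)]
    exact Submodule.span_mono hle⟩
  have hfin : Module.finrank ℤ L = d := by
    rw [ZLattice.rank ℝ L]; simp
  have : Module.Finite ℤ L := ZLattice.module_finite ℝ L
  have : Module.Free ℤ L := ZLattice.module_free ℝ L
  let b : Module.Basis (Fin d) ℤ L := Module.finBasisOfFinrankEq ℤ L hfin
  refine ⟨b.ofZLatticeBasis ℝ L, ?_⟩
  have hlat : lattice (b.ofZLatticeBasis ℝ L) = (L : Set (Vec d)) := by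
    rw [lattice, b.ofZLatticeBasis_span ℝ]
  have hne : (L : Set (Vec d)).Nonempty := ⟨0, L.zero_mem⟩
  have hclosed : IsClosed (L : Set (Vec d)) :=
    Metric.isClosed_of_pairwise_le_dist (ε := 2 * ε) (by positivity) fun x hx y hy hxy => by
      simpa only [dist_eq_norm] using hsep x hx y hy hxy
  set e : Vec d := EuclideanSpace.single ⟨0, hd⟩ (1 : ℝ) with he
  have hne1 : ‖e‖ = 1 := by simp [he]
  have heL : (2 * ε) • e ∈ L := hle (Submodule.subset_span ⟨⟨0, hd⟩, cubicBasis_apply hε _⟩)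
  have hcover : (3 * ε) ∈ {r : ℝ | ⋃ a ∈ (L : Set (Vec d)), Metric.closedBall a r = Set.univ} := by
    refine Set.eq_univ_of_forall fun p => ?_
    obtain ⟨z, hz, h⟩ := hclosed.exists_infDist_eq_dist hne p
    exact Set.mem_iUnion₂.2 ⟨z, hz, Metric.mem_closedBall.2
      (h ▸ infDist_le_of_maximal hε hle hL p)⟩
  have hcover_le : ∀ r ∈ {r : ℝ | ⋃ a ∈ (L : Set (Vec d)), Metric.closedBall a r = Set.univ},
      ε ≤ r := by
    intro r hr
    have hp : ε • e ∈ ⋃ a ∈ (L : Set (Vec d)), Metric.closedBall a r := by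
      rw [show ⋃ a ∈ (L : Set (Vec d)), Metric.closedBall a r = Set.univ from hr]; trivial
    obtain ⟨a, ha, hpa⟩ := Set.mem_iUnion₂.1 hp
    rw [Metric.mem_closedBall, dist_eq_norm] at hpa
    refine le_trans ?_ hpa
    have hee : ‖ε • e‖ = ε := by rw [norm_smul, hne1, Real.norm_of_nonneg hε.le, mul_one]
    by_cases h0 : a = 0
    · rw [h0, sub_zero, hee]
    · have h1 := hL.prop a ha h0
      have h2 := norm_sub_norm_le a (ε • e)
      rw [norm_sub_rev] at h2
      linarith
  refine ⟨?_, ?_, ?_⟩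
  · rw [packingRadius, hlat]
    refine IsGreatest.csSup_eq ⟨fun a ha b hb hab => ?_, fun r hr => ?_⟩
    · refine Metric.ball_disjoint_ball ?_
      rw [dist_eq_norm]; linarith [hsep a ha b hb hab]
    · by_contra! h
      have h0 : (0 : Vec d) ≠ (2 * ε) • e := by
        intro h0
        have : ‖(2 * ε) • e‖ = 2 * ε := by
          rw [norm_smul, hne1, Real.norm_of_nonneg (by positivity), mul_one]
        rw [← h0, norm_zero] at this
        linarith
      refine Set.disjoint_left.1 (hr 0 L.zero_mem _ heL h0) (?_ : ε • e ∈ _) ?_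
      · rw [Metric.mem_ball, dist_eq_norm, sub_zero, norm_smul, hne1,
          Real.norm_of_nonneg hε.le, mul_one]
        exact h
      · rw [Metric.mem_ball, dist_eq_norm, ← sub_smul, norm_smul, hne1,
          show ε - 2 * ε = -ε by ring, norm_neg, Real.norm_of_nonneg hε.le, mul_one]
        exact h
  · rw [coverRadius, hlat]
    exact le_csInf ⟨_, hcover⟩ hcover_le
  · rw [coverRadius, hlat]
    exact csInf_le ⟨ε, hcover_le⟩ hcover

end Existence

section Voronoi

open scoped Pointwise

variable {d : ℕ} {B : Module.Basis (Fin d) ℝ (Vec d)} {ε q : ℝ} {a b l x y : Vec d}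

lemma add_mem_voronoi_add_iff (hl : l ∈ lattice B) :
    x + l ∈ voronoi B (a + l) ↔ x ∈ voronoi B a := by
  constructor
  · intro h b hb hba
    simpa using h (b + l) (add_mem_lattice hb hl) (by simpa using hba)
  · intro h b hb hba
    have := h (b - l) (sub_mem_lattice hb hl) (by rwa [ne_eq, sub_eq_iff_eq_add])
    rwa [add_sub_add_right_eq_sub, show x + l - b = x - (b - l) by abel]

lemma neg_mem_voronoi_neg (h : x ∈ voronoi B a) : -x ∈ voronoi B (-a) := by
  intro b hb hba
  have := h (-b) (neg_mem_lattice hb) (by rintro rfl; simp at hba)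
  rwa [← norm_neg, ← norm_neg (-x - b), show -(-x - -a) = x - a by abel,
    show -(-x - b) = x - -b by abel]

lemma neg_mem_voronoi_neg_iff : -x ∈ voronoi B (-a) ↔ x ∈ voronoi B a :=
  ⟨fun h => by simpa using neg_mem_voronoi_neg h, neg_mem_voronoi_neg⟩

lemma sub_mem_voronoi_zero_iff (hl : l ∈ lattice B) : x - l ∈ voronoi B 0 ↔ x ∈ voronoi B l := by
  rw [← add_mem_voronoi_add_iff hl]; simp

lemma eq_of_mem_voronoi (ha : a ∈ lattice B) (hb : b ∈ lattice B) (h : x ∈ voronoi B a)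
    (h' : x ∈ voronoi B b) : a = b := by
  by_contra hab
  exact lt_asymm (h b hb (Ne.symm hab)) (h' a ha hab)

lemma voronoiExp_eq_add (B : Module.Basis (Fin d) ℝ (Vec d)) (ε q : ℝ) (a : Vec d) :
    voronoiExp B ε q a = voronoi B a + Metric.closedBall 0 (2 * q * ε) := by
  ext x
  simp only [voronoiExp, Set.mem_ofPred_eq, Set.mem_add, Metric.mem_closedBall, dist_zero_right]
  constructor
  · rintro ⟨v, hv, h⟩; exact ⟨v, hv, x - v, h, by abel⟩
  · rintro ⟨v, hv, w, hw, rfl⟩; exact ⟨v, hv, by simpa using hw⟩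

lemma add_mem_voronoiExp_add_iff (hl : l ∈ lattice B) :
    x + l ∈ voronoiExp B ε q (a + l) ↔ x ∈ voronoiExp B ε q a := by
  constructor
  · rintro ⟨v, hv, h⟩
    refine ⟨v - l, ?_, by rwa [show x - (v - l) = x + l - v by abel]⟩
    rw [← add_mem_voronoi_add_iff hl]; simpa using hv
  · rintro ⟨v, hv, h⟩
    exact ⟨v + l, (add_mem_voronoi_add_iff hl).2 hv, by simpa using h⟩

lemma neg_mem_voronoiExp_neg (h : x ∈ voronoiExp B ε q a) : -x ∈ voronoiExp B ε q (-a) := by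
  obtain ⟨v, hv, h⟩ := h
  refine ⟨-v, neg_mem_voronoi_neg hv, ?_⟩
  rwa [← norm_neg, show -(-x - -v) = x - v by abel]

lemma IsEpsLattice.isOpen_voronoi (hB : IsEpsLattice B ε) (hε : 0 < ε) (a : Vec d) :
    IsOpen (voronoi B a) := by
  have hcl : IsClosed (lattice B \ {a}) := hB.isClosed hε Set.sdiff_subset
  rcases (lattice B \ {a}).eq_empty_or_nonempty with h | h
  · convert isOpen_univ
    refine Set.eq_univ_of_forall fun x b hb hba => ?_
    exact absurd (show b ∈ lattice B \ {a} from ⟨hb, hba⟩) (by simp [h])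
  · have : voronoi B a = {x | dist x a < Metric.infDist x (lattice B \ {a})} := by
      ext x
      obtain ⟨z, hz, hxz⟩ := hcl.exists_infDist_eq_dist h x
      constructor
      · intro hx
        rw [Set.mem_ofPred_eq, hxz, dist_eq_norm, dist_eq_norm]
        exact hx z hz.1 hz.2
      · intro hx b hb hba
        rw [← dist_eq_norm, ← dist_eq_norm]
        exact lt_of_lt_of_le hx (Metric.infDist_le_dist_of_mem ⟨hb, hba⟩)
    rw [this]
    exact isOpen_lt (by fun_prop) (Metric.continuous_infDist_pt _)

lemma IsEpsLattice.isOpen_voronoiExp (hB : IsEpsLattice B ε) (hε : 0 < ε) (q : ℝ) (a : Vec d) :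
    IsOpen (voronoiExp B ε q a) := by
  rw [voronoiExp_eq_add]
  exact (hB.isOpen_voronoi hε a).add_right

lemma IsEpsLattice.ball_subset_voronoi (hB : IsEpsLattice B ε) :
    Metric.ball 0 ε ⊆ voronoi B 0 := by
  intro x hx b hb hb0
  rw [Metric.mem_ball, dist_zero_right] at hx
  have h1 := hB.two_mul_le_norm_sub hb (zero_mem_lattice B) hb0
  have h2 := norm_sub_norm_le b x
  rw [sub_zero] at h1 ⊢
  rw [norm_sub_rev x b]
  linarith

lemma IsEpsLattice.norm_sub_le_of_mem_voronoi (hB : IsEpsLattice B ε) (hε : 0 < ε)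
    (ha : a ∈ lattice B) (hx : x ∈ voronoi B a) : ‖x - a‖ ≤ 3 * ε := by
  rw [← hB.closestPoint_eq hε ha hx]
  exact hB.norm_sub_closestPoint_le_three hε x

lemma norm_lt_norm_sub_iff (x b : Vec d) : ‖x‖ < ‖x - b‖ ↔ 2 * inner ℝ x b < ‖b‖ ^ 2 := by
  rw [← sq_lt_sq₀ (norm_nonneg _) (norm_nonneg _), norm_sub_sq_real]
  constructor <;> intro h <;> linarith

/-- The expanded Voronoi region is contained in a dilation of the Voronoi region. -/
lemma IsEpsLattice.voronoiExp_subset_smul (hB : IsEpsLattice B ε) (hq : 0 < q) :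
    voronoiExp B ε q 0 ⊆ (1 + 2 * q) • voronoi B 0 := by
  rintro x ⟨v, hv, h⟩
  have hpos : 0 < 1 + 2 * q := by positivity
  rw [Set.mem_smul_set_iff_inv_smul_mem₀ hpos.ne']
  intro b hb hb0
  have h1 := hB.two_mul_le_norm_sub hb (zero_mem_lattice B) hb0
  have h2 := hv b hb hb0
  rw [sub_zero] at h1 h2 ⊢
  rw [norm_lt_norm_sub_iff] at h2 ⊢
  rw [inner_smul_left, RCLike.conj_to_real, mul_left_comm, inv_mul_lt_iff₀ hpos]
  have h3 : inner ℝ x b = inner ℝ v b + inner ℝ (x - v) b := by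
    rw [← inner_add_left]; simp
  have h4 : inner ℝ (x - v) b ≤ q * ‖b‖ ^ 2 := by
    calc inner ℝ (x - v) b ≤ ‖x - v‖ * ‖b‖ := real_inner_le_norm _ _
      _ ≤ (q * (2 * ε)) * ‖b‖ := by gcongr; linarith
      _ ≤ (q * ‖b‖) * ‖b‖ := by gcongr
      _ = q * ‖b‖ ^ 2 := by ring
  rw [h3]
  linarith

lemma IsEpsLattice.volume_voronoi_ne_zero (hB : IsEpsLattice B ε) (hε : 0 < ε) :
    volume (voronoi B 0) ≠ 0 :=
  ((Metric.measure_ball_pos volume 0 hε).trans_le (measure_mono hB.ball_subset_voronoi)).ne'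

lemma IsEpsLattice.volume_voronoi_ne_top (hB : IsEpsLattice B ε) (hε : 0 < ε) :
    volume (voronoi B 0) ≠ ⊤ := by
  refine ne_top_of_le_ne_top (measure_closedBall_lt_top (x := (0 : Vec d)) (r := 3 * ε)).ne
    (measure_mono fun x hx => ?_)
  rw [Metric.mem_closedBall, dist_eq_norm]
  exact hB.norm_sub_le_of_mem_voronoi hε (zero_mem_lattice B) hx

lemma IsEpsLattice.volume_voronoiExp_le (hB : IsEpsLattice B ε) (hq : 0 < q) :
    volume (voronoiExp B ε q 0) ≤ ENNReal.ofReal ((1 + 2 * q) ^ d) * volume (voronoi B 0) := by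
  refine (measure_mono (hB.voronoiExp_subset_smul hq)).trans_eq ?_
  rw [Measure.addHaar_smul, finrank_euclideanSpace_fin, abs_of_nonneg (by positivity)]

/-- Almost every point lies in a Voronoi region. -/
lemma IsEpsLattice.ae_exists_mem_voronoi (hB : IsEpsLattice B ε) (hε : 0 < ε) :
    ∀ᵐ y : Vec d, ∃ z ∈ lattice B, y ∈ voronoi B z := by
  have hnull : ∀ᵐ y : Vec d, ∀ a ∈ lattice B, ∀ b ∈ lattice B, a ≠ b →
      y ∉ AffineSubspace.perpBisector a b := by
    rw [ae_ball_iff (countable_lattice B)]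
    intro a _
    rw [ae_ball_iff (countable_lattice B)]
    intro b _
    by_cases hab : a = b
    · simp [hab]
    · have := Measure.addHaar_affineSubspace volume (AffineSubspace.perpBisector a b)
        (by simpa using hab)
      filter_upwards [measure_eq_zero_iff_ae_notMem.1 this] with y hy _
      exact hy
  filter_upwards [hnull] with y hy
  have hz := hB.closestPoint_mem hε y
  refine ⟨_, hz, fun b hb hba => ?_⟩
  refine lt_of_le_of_ne (hB.norm_sub_closestPoint_le hε y hb) fun h => ?_
  refine hy _ hz b hb hba.symm ?_
  rw [AffineSubspace.mem_perpBisector_iff_dist_eq, dist_eq_norm, dist_eq_norm, h]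

/-- The lattice as a subgroup. -/
abbrev latticeSubgroup (B : Module.Basis (Fin d) ℝ (Vec d)) : AddSubgroup (Vec d) :=
  (Submodule.span ℤ (Set.range B)).toAddSubgroup

instance : Countable (latticeSubgroup B) :=
  inferInstanceAs (Countable (Submodule.span ℤ (Set.range B)))

lemma IsEpsLattice.isAddFundamentalDomain (hB : IsEpsLattice B ε) (hε : 0 < ε) :
    IsAddFundamentalDomain (latticeSubgroup B) (voronoi B 0) volume where
  nullMeasurableSet := (hB.isOpen_voronoi hε 0).measurableSet.nullMeasurableSet
  ae_covers := by
    filter_upwards [hB.ae_exists_mem_voronoi hε] with y ⟨z, hz, hy⟩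
    refine ⟨⟨-z, neg_mem_lattice hz⟩, ?_⟩
    rw [← sub_mem_voronoi_zero_iff hz] at hy
    rwa [AddSubgroup.vadd_def, vadd_eq_add, neg_add_eq_sub]
  aedisjoint := by
    intro g h hgh
    refine Disjoint.aedisjoint (Set.disjoint_left.2 ?_)
    rintro _ ⟨v, hv, rfl⟩ ⟨w, hw, hwv⟩
    refine hgh (Subtype.ext (eq_of_mem_voronoi (x := (g : Vec d) + v) g.2 h.2 ?_ ?_))
    · rw [← sub_mem_voronoi_zero_iff g.2]; simpa using hv
    · rw [← sub_mem_voronoi_zero_iff h.2]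
      have : (h : Vec d) + w = g + v := hwv
      rw [← this]; simpa using hw

/-- The integral of a periodic function over the Voronoi region does not change when the function
is translated. -/
lemma IsEpsLattice.setIntegral_voronoi_add (hB : IsEpsLattice B ε) (hε : 0 < ε) {f : Vec d → Vec d}
    (hf : ∀ l ∈ lattice B, ∀ y, f (y + l) = f y) (x : Vec d) :
    ∫ θ in voronoi B 0, f (x + θ) = ∫ θ in voronoi B 0, f θ := by
  have hV := hB.isAddFundamentalDomain hε
  refine Eq.trans ?_ (hV.setIntegral_eq (hV.vadd_of_comm x) fun g y => by
    rw [AddSubgroup.vadd_def, vadd_eq_add, add_comm]; exact hf _ g.2 y).symm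
  exact ((measurePreserving_add_left volume x).setIntegral_image_emb
    (measurableEmbedding_addLeft x) f _).symm

/-- The integral over the Voronoi region of an odd function vanishes. -/
lemma setIntegral_voronoi_eq_zero_of_odd {f : Vec d → Vec d} (hf : ∀ y, f (-y) = -f y) :
    ∫ θ in voronoi B 0, f θ = 0 := by
  have h := (Measure.measurePreserving_neg (volume : Measure (Vec d))).setIntegral_preimage_emb
    (Homeomorph.neg (Vec d)).measurableEmbedding f (voronoi B 0)
  have hV : Neg.neg ⁻¹' voronoi B 0 = voronoi B 0 := by
    ext y
    simpa using neg_mem_voronoi_neg_iff (B := B) (x := y) (a := 0)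
  rw [show (fun y : Vec d => -y) ⁻¹' voronoi B 0 = voronoi B 0 from hV] at h
  simp only [hf, integral_neg] at h
  rw [neg_eq_iff_add_eq_zero, ← two_smul ℝ, smul_eq_zero] at h
  exact h.resolve_left two_ne_zero

/-- The expected number of expanded Voronoi regions that contain a uniformly random translate. -/
lemma IsEpsLattice.setLIntegral_tsum_voronoiExp (hB : IsEpsLattice B ε) (hε : 0 < ε) (x : Vec d) :
    ∫⁻ θ in voronoi B 0, ∑' b : latticeSubgroup B,
      (voronoiExp B ε q (b : Vec d)).indicator 1 (x + θ) = volume (voronoiExp B ε q 0) := by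
  have hmeas := (hB.isOpen_voronoiExp hε q 0).measurableSet
  rw [lintegral_tsum (f := fun (b : latticeSubgroup B) θ =>
    (voronoiExp B ε q (b : Vec d)).indicator 1 (x + θ)) fun b => ((measurable_one.indicator
      (hB.isOpen_voronoiExp hε q (b : Vec d)).measurableSet).comp
        (measurable_const_add x)).aemeasurable]
  have h := (hB.isAddFundamentalDomain hε).lintegral_eq_tsum'
    fun θ => (voronoiExp B ε q 0).indicator (1 : Vec d → ENNReal) (x + θ)
  rw [lintegral_add_left_eq_self, lintegral_indicator_one hmeas] at h
  rw [h]
  refine tsum_congr fun b => setLIntegral_congr_fun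
    (hB.isOpen_voronoi hε 0).measurableSet fun θ _ => ?_
  refine Set.indicator_eq_indicator ?_ rfl
  rw [AddSubgroup.vadd_def, vadd_eq_add,
    ← add_mem_voronoiExp_add_iff (x := x + _) (a := 0) (l := (b : Vec d)) b.2, zero_add,
    NegMemClass.coe_neg, show x + (-(b : Vec d) + θ) + b = x + θ by abel]

end Voronoi

section BaseColor

variable {d : ℕ} {B : Module.Basis (Fin d) ℝ (Vec d)} {ε q : ℝ} {a b l x y z : Vec d}

lemma floor_repr_eq (ha : a ∈ lattice B) (j : Fin d) : (⌊B.repr a j⌋ : ℝ) = B.repr a j := by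
  obtain ⟨k, hk⟩ := (B.mem_span_iff_repr_mem ℤ a).1 ha j
  rw [← hk]; simp

lemma baseColor_add (ha : a ∈ lattice B) (hb : b ∈ lattice B) :
    baseColor B q (a + b) = baseColor B q a + baseColor B q b := by
  funext j
  have : ⌊B.repr (a + b) j⌋ = ⌊B.repr a j⌋ + ⌊B.repr b j⌋ := by
    rw [map_add, Finsupp.add_apply, ← floor_repr_eq ha j, ← floor_repr_eq hb j, ← Int.cast_add]
    simp only [Int.floor_intCast]
  simp only [baseColor, this, Pi.add_apply, Int.cast_add]

lemma baseColor_neg (ha : a ∈ lattice B) : baseColor B q (-a) = -baseColor B q a := by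
  have h := baseColor_add (q := q) ha (neg_mem_lattice ha)
  have h0 : baseColor B q 0 = 0 := by funext j; simp [baseColor]
  rw [add_neg_cancel, h0] at h
  exact (neg_eq_of_add_eq_zero_right h.symm).symm

/-- Distinct lattice points of the same initial color are far apart. -/
lemma IsEpsLattice.le_norm_sub_of_baseColor_eq (hB : IsEpsLattice B ε) (hε : 0 < ε)
    (hq : 0 < q) (ha : a ∈ lattice B) (hb : b ∈ lattice B) (hab : a ≠ b)
    (h : baseColor B q a = baseColor B q b) : (3 + 2 * q) * (2 * ε) ≤ ‖a - b‖ := by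
  have hm : 3 + 2 * q ≤ modulus q := Nat.le_ceil _
  have hm0 : (0 : ℝ) < modulus q := lt_of_lt_of_le (by positivity) hm
  have hl : (modulus q : ℝ)⁻¹ • (a - b) ∈ lattice B := by
    refine (B.mem_span_iff_repr_mem ℤ _).2 fun j => ?_
    have hj := congrFun h j
    rw [baseColor, baseColor, ZMod.intCast_eq_intCast_iff_dvd_sub] at hj
    obtain ⟨t, ht⟩ := hj
    refine ⟨-t, ?_⟩
    have ht' : B.repr b j - B.repr a j = modulus q * t := by
      rw [← floor_repr_eq ha j, ← floor_repr_eq hb j]; exact_mod_cast ht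
    rw [map_smul, map_sub, Finsupp.smul_apply, Finsupp.sub_apply, smul_eq_mul,
      ← neg_sub, ht']
    simp [hm0.ne']
  have h1 := hB.two_mul_le_norm_sub hl (zero_mem_lattice B)
    (smul_ne_zero (inv_ne_zero hm0.ne') (sub_ne_zero.2 hab))
  rw [sub_zero, norm_smul, norm_inv, Real.norm_of_nonneg hm0.le, le_inv_mul_iff₀ hm0] at h1
  refine le_trans ?_ h1
  gcongr

/-- Two lattice points whose expanded Voronoi regions compete for `y` have different initial
colors. -/
lemma IsEpsLattice.baseColor_ne (hB : IsEpsLattice B ε) (hε : 0 < ε) (hq : 0 < q)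
    (ha : a ∈ lattice B) (hb : b ∈ lattice B) (hab : a ≠ b) (hya : y ∈ voronoi B a)
    (hyb : y ∈ voronoiExp B ε q b) : baseColor B q a ≠ baseColor B q b := by
  intro h
  have h1 := hB.le_norm_sub_of_baseColor_eq hε hq ha hb hab h
  obtain ⟨v, hv, hyv⟩ := hyb
  have h2 := hB.norm_sub_le_of_mem_voronoi hε ha hya
  have h3 := hB.norm_sub_le_of_mem_voronoi hε hb hv
  have h4 : ‖a - b‖ ≤ ‖y - a‖ + ‖y - v‖ + ‖v - b‖ := by
    rw [← norm_neg (y - a)]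
    refine le_trans (le_of_eq ?_) norm_add₃_le
    congr 1; abel
  nlinarith [mul_pos hq hε]

end BaseColor

section Uniform

/-- The uniform distribution on a finite type is invariant under bijections. -/
lemma uniformOn_univ_preimage {α : Type*} [Finite α] [MeasurableSpace α]
    [MeasurableSingletonClass α] (e : α ≃ α) (s : Set α) :
    uniformOn Set.univ (e ⁻¹' s) = uniformOn Set.univ s := by
  cases nonempty_fintype α
  rw [uniformOn_univ, uniformOn_univ, Measure.count_apply (Set.toFinite _).measurableSet,
    Measure.count_apply (Set.toFinite _).measurableSet,
    Set.encard_preimage_of_bijective e.bijective]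

/-- A uniformly random map takes the same value at two distinct points with probability at most
one over the number of values. -/
lemma uniformOn_univ_apply_eq_le {ι : Type*} [Finite ι] {k : ℕ} {i j : ι}
    (hij : i ≠ j) : uniformOn Set.univ {f : ι → Fin k | f i = f j} ≤ (k : ENNReal)⁻¹ := by
  classical
  cases nonempty_fintype ι
  have hcard : Fintype.card {f : ι → Fin k // f i = f j} * k ≤ Fintype.card (ι → Fin k) := by
    rw [show Fintype.card {f : ι → Fin k // f i = f j} * k =
      Fintype.card ({f : ι → Fin k // f i = f j} × Fin k) by simp]
    refine Fintype.card_le_of_injective (fun p => Function.update p.1.1 i p.2) ?_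
    rintro ⟨⟨f, hf⟩, a⟩ ⟨⟨g, hg⟩, b⟩ h
    simp only at h
    have hab : a = b := by simpa using congrFun h i
    have hoff : ∀ m, m ≠ i → f m = g m := fun m hm => by simpa [hm] using congrFun h m
    have hfg : f = g := by
      funext m
      by_cases hm : m = i
      · rw [hm, hf, hg, hoff j hij.symm]
      · exact hoff m hm
    subst hab hfg
    rfl
  rw [uniformOn_univ, Measure.count_apply (Set.toFinite _).measurableSet,
    Set.encard_eq_coe_toFinset_card, Set.toFinset_card]
  rcases Nat.eq_zero_or_pos k with rfl | hk
  · simp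
  rw [ENNReal.le_inv_iff_mul_le, ENNReal.div_eq_inv_mul, mul_assoc]
  have : Nonempty (ι → Fin k) := ⟨fun _ => ⟨0, hk⟩⟩
  refine ENNReal.inv_mul_le_iff (by exact_mod_cast Fintype.card_ne_zero) (by simp) |>.2 ?_
  rw [mul_one]
  exact_mod_cast hcard

end Uniform

section Accepts

variable {d : ℕ} {B : Module.Basis (Fin d) ℝ (Vec d)} {ε q : ℝ} {a b l x y z : Vec d}

/-- The maps from initial colors to final colors. -/
abbrev ColorMap (d : ℕ) (q : ℝ) := (Fin d → ZMod (modulus q)) → Fin (numColors d q)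

instance [hq : Fact (0 < q)] : NeZero (modulus q) :=
  ⟨(Nat.ceil_pos.2 (by have := hq.out; positivity)).ne'⟩

instance [hq : Fact (0 < q)] : NeZero (numColors d q) :=
  ⟨(Nat.ceil_pos.2 (by have := hq.out; positivity)).ne'⟩

instance [Fact (0 < q)] : IsProbabilityMeasure (uniformOn Set.univ : Measure (ColorMap d q)) :=
  isProbabilityMeasure_uniformOn Set.finite_univ Set.univ_nonempty

/-- The shifted input `y` lies in a Voronoi region, and the color map `f` distinguishes the center
of this region from all other lattice points whose expanded Voronoi region contains `y`. -/
def Accepts (B : Module.Basis (Fin d) ℝ (Vec d)) (ε q : ℝ) (y : Vec d) (f : ColorMap d q) : Prop :=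
  ∃ z ∈ lattice B, y ∈ voronoi B z ∧ ∀ b ∈ lattice B, b ≠ z → y ∈ voronoiExp B ε q b →
    f (baseColor B q z) ≠ f (baseColor B q b)

lemma IsEpsLattice.accepts_iff (hB : IsEpsLattice B ε) (hε : 0 < ε) (hz : z ∈ lattice B)
    {t : Trial d q} (hx : x + t.1 ∈ voronoi B z) :
    Successful B ε q t x ↔ Accepts B ε q (x + t.1) t.2 := by
  have hr : rounded B t x = z := hB.closestPoint_eq hε hz hx
  rw [Successful, hr]
  push Not
  constructor
  · exact fun h => ⟨z, hz, hx, fun b hb hbz hxb => h b hb hbz hxb⟩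
  · rintro ⟨w, hw, hxw, h⟩
    obtain rfl := eq_of_mem_voronoi hz hw hx hxw
    exact h

/-- The acceptance set is measurable. -/
lemma IsEpsLattice.measurableSet_accepts [Fact (0 < q)] (hB : IsEpsLattice B ε) (hε : 0 < ε) :
    MeasurableSet {p : Vec d × ColorMap d q | Accepts B ε q p.1 p.2} := by
  have hL := countable_lattice B
  have h : {p : Vec d × ColorMap d q | Accepts B ε q p.1 p.2} =
      ⋃ z ∈ lattice B, (voronoi B z ×ˢ Set.univ) ∩ ⋂ b ∈ lattice B,
        ({p | b = z} ∪ ((voronoiExp B ε q b)ᶜ ×ˢ Set.univ)) ∪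
          (Set.univ ×ˢ {f | f (baseColor B q z) ≠ f (baseColor B q b)}) := by
    ext ⟨y, f⟩
    simp only [Accepts, Set.mem_ofPred_eq, Set.mem_iUnion, Set.mem_inter_iff, Set.mem_iInter,
      Set.mem_union, Set.mem_prod, Set.mem_univ, and_true, true_and, Set.mem_compl_iff,
      exists_prop]
    refine exists_congr fun z => and_congr_right fun _ => and_congr_right fun _ =>
      forall₂_congr fun b _ => ?_
    tauto
  rw [h]
  refine MeasurableSet.biUnion hL fun z _ => MeasurableSet.inter ?_
    (MeasurableSet.biInter hL fun b _ => ((MeasurableSet.const _).union ?_).union ?_)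
  · exact (hB.isOpen_voronoi hε z).measurableSet.prod MeasurableSet.univ
  · exact (hB.isOpen_voronoiExp hε q b).measurableSet.compl.prod MeasurableSet.univ
  · exact MeasurableSet.univ.prod (Set.toFinite _).measurableSet

lemma accepts_add_iff (hl : l ∈ lattice B) (f : ColorMap d q) :
    Accepts B ε q (y + l) f ↔ Accepts B ε q y (f ∘ (· + baseColor B q l)) := by
  constructor
  · rintro ⟨z, hz, hyz, h⟩
    have hz' := sub_mem_lattice hz hl
    refine ⟨z - l, hz', ?_, fun b hb hbz hyb => ?_⟩
    · rw [← add_mem_voronoi_add_iff hl]; simpa using hyz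
    · have := h (b + l) (add_mem_lattice hb hl) (by rwa [ne_eq, ← eq_sub_iff_add_eq])
        ((add_mem_voronoiExp_add_iff hl).2 hyb)
      rw [Function.comp_apply, Function.comp_apply, ← baseColor_add hz' hl, ← baseColor_add hb hl]
      simpa using this
  · rintro ⟨z, hz, hyz, h⟩
    refine ⟨z + l, add_mem_lattice hz hl, (add_mem_voronoi_add_iff hl).2 hyz,
      fun b hb hbz hyb => ?_⟩
    have hb' := sub_mem_lattice hb hl
    have := h (b - l) hb' (by rwa [ne_eq, sub_eq_iff_eq_add]) (by
      rw [← add_mem_voronoiExp_add_iff hl]; simpa using hyb)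
    rw [Function.comp_apply, Function.comp_apply, ← baseColor_add hz hl,
      ← baseColor_add hb' hl] at this
    simpa using this

lemma Accepts.neg {f : ColorMap d q} (h : Accepts B ε q y f) :
    Accepts B ε q (-y) (f ∘ Neg.neg) := by
  obtain ⟨z, hz, hyz, h⟩ := h
  refine ⟨-z, neg_mem_lattice hz, neg_mem_voronoi_neg hyz, fun b hb hbz hyb => ?_⟩
  have hb' := neg_mem_lattice hb
  have := h (-b) hb' (by rintro rfl; simp at hbz) (by simpa using neg_mem_voronoiExp_neg hyb)
  rwa [Function.comp_apply, Function.comp_apply, baseColor_neg hz, neg_neg, ← baseColor_neg hb]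

lemma accepts_neg_iff (f : ColorMap d q) :
    Accepts B ε q (-y) f ↔ Accepts B ε q y (f ∘ Neg.neg) :=
  ⟨fun h => by simpa using h.neg,
    fun h => by simpa [Function.comp_assoc, show Neg.neg ∘ Neg.neg = (id : (Fin d →
      ZMod (modulus q)) → _) from funext fun _ => neg_neg _] using h.neg⟩

/-- The probability, over a random color map, that `y` is accepted. -/
noncomputable def acceptProb (B : Module.Basis (Fin d) ℝ (Vec d)) (ε q : ℝ) (y : Vec d) : ℝ :=
  (uniformOn Set.univ : Measure (ColorMap d q)).real {f | Accepts B ε q y f}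

lemma acceptProb_add [Fact (0 < q)] (hl : l ∈ lattice B) (y : Vec d) :
    acceptProb B ε q (y + l) = acceptProb B ε q y := by
  rw [acceptProb, acceptProb, Measure.real, Measure.real]
  congr 1
  simp only [accepts_add_iff hl]
  exact uniformOn_univ_preimage
    ((Equiv.addRight (baseColor B q l)).symm.arrowCongr (Equiv.refl _)) {f | Accepts B ε q y f}

lemma acceptProb_neg [Fact (0 < q)] (y : Vec d) :
    acceptProb B ε q (-y) = acceptProb B ε q y := by
  rw [acceptProb, acceptProb, Measure.real, Measure.real]
  congr 1
  simp only [accepts_neg_iff]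
  exact uniformOn_univ_preimage
    ((Equiv.neg (Fin d → ZMod (modulus q))).symm.arrowCongr (Equiv.refl _))
    {f | Accepts B ε q y f}

/-- For fixed `y`, a random color map fails with probability at most the number of expanded
Voronoi regions containing `y` divided by the number of colors. -/
lemma IsEpsLattice.uniformOn_not_accepts_le [hq : Fact (0 < q)] (hB : IsEpsLattice B ε)
    (hε : 0 < ε) (hz : z ∈ lattice B) (hy : y ∈ voronoi B z) :
    (uniformOn Set.univ : Measure (ColorMap d q)) {f | ¬ Accepts B ε q y f} ≤
      (∑' b : latticeSubgroup B, (voronoiExp B ε q (b : Vec d)).indicator 1 y) *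
        (numColors d q : ENNReal)⁻¹ := by
  rw [← ENNReal.tsum_mul_right]
  have hsub : {f : ColorMap d q | ¬ Accepts B ε q y f} ⊆ ⋃ b : latticeSubgroup B,
      {f | (b : Vec d) ≠ z ∧ y ∈ voronoiExp B ε q b ∧
        f (baseColor B q z) = f (baseColor B q b)} := by
    intro f hf
    by_contra h
    refine hf ⟨z, hz, hy, fun b hb hbz hyb hfb => h ?_⟩
    exact Set.mem_iUnion.2 ⟨⟨b, hb⟩, hbz, hyb, hfb⟩
  refine (measure_mono hsub).trans ((measure_iUnion_le _).trans (ENNReal.tsum_le_tsum fun b => ?_))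
  by_cases h : (b : Vec d) ≠ z ∧ y ∈ voronoiExp B ε q b
  · rw [Set.indicator_of_mem h.2, Pi.one_apply, one_mul]
    refine (measure_mono fun f hf => hf.2.2).trans (uniformOn_univ_apply_eq_le ?_)
    exact hB.baseColor_ne hε hq.out hz b.2 h.1.symm hy h.2
  · rw [show {f : ColorMap d q | (b : Vec d) ≠ z ∧ y ∈ voronoiExp B ε q b ∧
        f (baseColor B q z) = f (baseColor B q b)} = ∅ from
      Set.eq_empty_of_forall_notMem fun f hf => h ⟨hf.1, hf.2.1⟩]
    simp

end Accepts

section Residual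

variable {d : ℕ} {B : Module.Basis (Fin d) ℝ (Vec d)} {ε q : ℝ} {a b l x y z : Vec d}

open Classical in
/-- The vector from `y` to the center of its Voronoi region. -/
noncomputable def residual (B : Module.Basis (Fin d) ℝ (Vec d)) (y : Vec d) : Vec d :=
  if ∃ z ∈ lattice B, y ∈ voronoi B z then closestPoint B y - y else 0

lemma IsEpsLattice.residual_eq (hB : IsEpsLattice B ε) (hε : 0 < ε) (hz : z ∈ lattice B)
    (hy : y ∈ voronoi B z) : residual B y = z - y := by
  rw [residual, if_pos ⟨z, hz, hy⟩, hB.closestPoint_eq hε hz hy]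

lemma residual_eq_zero (h : ¬ ∃ z ∈ lattice B, y ∈ voronoi B z) : residual B y = 0 := if_neg h

lemma IsEpsLattice.norm_residual_le (hB : IsEpsLattice B ε) (hε : 0 < ε) (y : Vec d) :
    ‖residual B y‖ ≤ 3 * ε := by
  rw [residual]
  split_ifs
  · rw [norm_sub_rev]; exact hB.norm_sub_closestPoint_le_three hε y
  · rw [norm_zero]; positivity

lemma IsEpsLattice.residual_add (hB : IsEpsLattice B ε) (hε : 0 < ε) (hl : l ∈ lattice B)
    (y : Vec d) : residual B (y + l) = residual B y := by
  by_cases h : ∃ z ∈ lattice B, y ∈ voronoi B z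
  · obtain ⟨z, hz, hy⟩ := h
    rw [hB.residual_eq hε hz hy, hB.residual_eq hε (add_mem_lattice hz hl)
      ((add_mem_voronoi_add_iff hl).2 hy)]
    abel
  · rw [residual_eq_zero h, residual_eq_zero]
    rintro ⟨z, hz, hy⟩
    refine h ⟨z - l, sub_mem_lattice hz hl, ?_⟩
    rw [← add_mem_voronoi_add_iff hl]; simpa using hy

lemma IsEpsLattice.residual_neg (hB : IsEpsLattice B ε) (hε : 0 < ε) (y : Vec d) :
    residual B (-y) = -residual B y := by
  by_cases h : ∃ z ∈ lattice B, y ∈ voronoi B z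
  · obtain ⟨z, hz, hy⟩ := h
    rw [hB.residual_eq hε hz hy, hB.residual_eq hε (neg_mem_lattice hz) (neg_mem_voronoi_neg hy)]
    abel
  · rw [residual_eq_zero h, residual_eq_zero, neg_zero]
    rintro ⟨z, hz, hy⟩
    exact h ⟨-z, neg_mem_lattice hz, by simpa using neg_mem_voronoi_neg hy⟩

lemma IsEpsLattice.measurableSet_exists_mem_voronoi (hB : IsEpsLattice B ε) (hε : 0 < ε) :
    MeasurableSet {y | ∃ z ∈ lattice B, y ∈ voronoi B z} := by
  have : {y | ∃ z ∈ lattice B, y ∈ voronoi B z} = ⋃ z ∈ lattice B, voronoi B z := by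
    ext; simp
  rw [this]
  exact MeasurableSet.biUnion (countable_lattice B) fun z _ => (hB.isOpen_voronoi hε z).measurableSet

lemma IsEpsLattice.measurable_residual (hB : IsEpsLattice B ε) (hε : 0 < ε) :
    Measurable (residual B) := by
  intro s hs
  have : residual B ⁻¹' s = (⋃ z ∈ lattice B, voronoi B z ∩ {y | z - y ∈ s}) ∪
      ({y | ∃ z ∈ lattice B, y ∈ voronoi B z}ᶜ ∩ {_y | (0 : Vec d) ∈ s}) := by
    ext y
    simp only [Set.mem_preimage, Set.mem_union, Set.mem_iUnion, Set.mem_inter_iff,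
      Set.mem_compl_iff, Set.mem_ofPred_eq, exists_prop]
    by_cases h : ∃ z ∈ lattice B, y ∈ voronoi B z
    · obtain ⟨z, hz, hy⟩ := h
      rw [hB.residual_eq hε hz hy]
      constructor
      · exact fun h => Or.inl ⟨z, hz, hy, h⟩
      · rintro (⟨w, hw, hyw, h⟩ | ⟨h, _⟩)
        · rwa [eq_of_mem_voronoi hz hw hy hyw]
        · exact absurd ⟨z, hz, hy⟩ h
    · rw [residual_eq_zero h]
      constructor
      · exact fun h0 => Or.inr ⟨h, h0⟩
      · rintro (⟨w, hw, hyw, _⟩ | ⟨_, h0⟩)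
        · exact absurd ⟨w, hw, hyw⟩ h
        · exact h0
  rw [this]
  refine (MeasurableSet.biUnion (countable_lattice B) fun z _ =>
    (hB.isOpen_voronoi hε z).measurableSet.inter ?_).union
    ((hB.measurableSet_exists_mem_voronoi hε).compl.inter (MeasurableSet.const _))
  exact (measurable_const.sub measurable_id : Measurable fun y => z - y) hs

end Residual

section Trial

variable {d : ℕ} {B : Module.Basis (Fin d) ℝ (Vec d)} {ε q : ℝ} {x : Vec d}

lemma IsEpsLattice.isProbabilityMeasure_cond (hB : IsEpsLattice B ε) (hε : 0 < ε) :
    IsProbabilityMeasure (ProbabilityTheory.cond volume (voronoi B 0)) :=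
  cond_isProbabilityMeasure_of_finite (hB.volume_voronoi_ne_zero hε) (hB.volume_voronoi_ne_top hε)

lemma IsEpsLattice.isProbabilityMeasure_trial [Fact (0 < q)] (hB : IsEpsLattice B ε)
    (hε : 0 < ε) : IsProbabilityMeasure (trialMeasure B q) := by
  have := hB.isProbabilityMeasure_cond hε
  rw [trialMeasure]; infer_instance

/-- The trials accepted for the input `x`. -/
def acceptSet (B : Module.Basis (Fin d) ℝ (Vec d)) (ε q : ℝ) (x : Vec d) : Set (Trial d q) :=
  {t | Accepts B ε q (x + t.1) t.2}

lemma IsEpsLattice.measurableSet_acceptSet [Fact (0 < q)] (hB : IsEpsLattice B ε) (hε : 0 < ε) :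
    MeasurableSet (acceptSet B ε q x) :=
  ((measurable_fst.const_add x).prodMk measurable_snd) (hB.measurableSet_accepts hε)

lemma IsEpsLattice.ae_cond_exists_mem_voronoi (hB : IsEpsLattice B ε) (hε : 0 < ε) (x : Vec d) :
    ∀ᵐ θ ∂(ProbabilityTheory.cond volume (voronoi B 0)),
      ∃ z ∈ lattice B, x + θ ∈ voronoi B z :=
  cond_absolutelyContinuous.ae_le
    ((measurePreserving_add_left volume x).quasiMeasurePreserving.ae (hB.ae_exists_mem_voronoi hε))

lemma IsEpsLattice.ae_trial_exists_mem_voronoi [Fact (0 < q)] (hB : IsEpsLattice B ε)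
    (hε : 0 < ε) (x : Vec d) :
    ∀ᵐ t ∂(trialMeasure B q), ∃ z ∈ lattice B, x + t.1 ∈ voronoi B z := by
  have := hB.isProbabilityMeasure_cond hε
  exact Measure.quasiMeasurePreserving_fst.ae (hB.ae_cond_exists_mem_voronoi hε x)

lemma ofReal_pow_mul_inv_numColors_le [hq : Fact (0 < q)] (d : ℕ) :
    ENNReal.ofReal ((1 + 2 * q) ^ d) * (numColors d q : ENNReal)⁻¹ ≤
      ENNReal.ofReal (((1 + 2 * q) ^ (2 * d))⁻¹) := by
  have hq0 := hq.out
  have hK : (0 : ℝ) < numColors d q := by exact_mod_cast Nat.pos_of_ne_zero (NeZero.ne _)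
  have hK' : (1 + 2 * q) ^ (3 * d) ≤ numColors d q := Nat.le_ceil _
  rw [← ENNReal.ofReal_natCast, ← ENNReal.ofReal_inv_of_pos hK,
    ← ENNReal.ofReal_mul (by positivity)]
  refine ENNReal.ofReal_le_ofReal ?_
  rw [← div_eq_mul_inv, div_le_iff₀ hK, le_inv_mul_iff₀ (by positivity), ← pow_add]
  refine le_trans (le_of_eq ?_) hK'
  congr 1
  omega

/-- A single trial fails with probability at most `(1 + 2 q) ^ (-2 d)`. -/
lemma IsEpsLattice.trialMeasure_compl_acceptSet_le [hq : Fact (0 < q)] (hB : IsEpsLattice B ε)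
    (hε : 0 < ε) (x : Vec d) :
    trialMeasure B q (acceptSet B ε q x)ᶜ ≤ ENNReal.ofReal (((1 + 2 * q) ^ (2 * d))⁻¹) := by
  have := hB.isProbabilityMeasure_cond hε
  have hV0 := hB.volume_voronoi_ne_zero hε
  have hVt := hB.volume_voronoi_ne_top hε
  refine le_trans ?_ (ofReal_pow_mul_inv_numColors_le d)
  rw [trialMeasure, Measure.prod_apply (hB.measurableSet_acceptSet hε).compl]
  have h1 : ∫⁻ θ, uniformOn Set.univ (Prod.mk θ ⁻¹' (acceptSet B ε q x)ᶜ)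
        ∂(ProbabilityTheory.cond volume (voronoi B 0)) ≤
      ∫⁻ θ, (∑' b : latticeSubgroup B, (voronoiExp B ε q (b : Vec d)).indicator 1 (x + θ)) *
        (numColors d q : ENNReal)⁻¹ ∂(ProbabilityTheory.cond volume (voronoi B 0)) := by
    refine lintegral_mono_ae ?_
    filter_upwards [hB.ae_cond_exists_mem_voronoi hε x] with θ ⟨z, hz, hy⟩
    have : Prod.mk θ ⁻¹' (acceptSet B ε q x)ᶜ = {f | ¬ Accepts B ε q (x + θ) f} := by
      ext f; exact Iff.rfl
    rw [this]
    exact hB.uniformOn_not_accepts_le hε hz hy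
  refine h1.trans ?_
  rw [lintegral_mul_const' _ _
    (ENNReal.inv_ne_top.2 (by exact_mod_cast NeZero.ne (numColors d q)))]
  gcongr
  rw [ProbabilityTheory.cond, lintegral_smul_measure, hB.setLIntegral_tsum_voronoiExp hε x,
    smul_eq_mul, ENNReal.inv_mul_le_iff hV0 hVt, mul_comm]
  exact hB.volume_voronoiExp_le hq.out

/-- Conditioned on acceptance, the residual has mean zero. -/
lemma IsEpsLattice.setIntegral_acceptSet_residual [Fact (0 < q)] (hB : IsEpsLattice B ε)
    (hε : 0 < ε) (x : Vec d) :
    ∫ t in acceptSet B ε q x, residual B (x + t.1) ∂(trialMeasure B q) = 0 := by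
  have := hB.isProbabilityMeasure_cond hε
  have := hB.isProbabilityMeasure_trial (q := q) hε
  have hS := hB.measurableSet_acceptSet (q := q) (x := x) hε
  have hmeas : Measurable fun t : Trial d q => residual B (x + t.1) :=
    (hB.measurable_residual hε).comp (measurable_fst.const_add x)
  have hint : Integrable (fun t : Trial d q => residual B (x + t.1)) (trialMeasure B q) :=
    Integrable.of_bound hmeas.aestronglyMeasurable (3 * ε)
      (Filter.Eventually.of_forall fun t => hB.norm_residual_le hε _)
  rw [← integral_indicator hS, trialMeasure, integral_prod _ (hint.indicator hS)]
  have hinner : ∀ θ : Vec d, ∫ f, (acceptSet B ε q x).indicator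
      (fun t : Trial d q => residual B (x + t.1)) (θ, f) ∂(uniformOn Set.univ) =
      acceptProb B ε q (x + θ) • residual B (x + θ) := by
    intro θ
    have : (fun f : ColorMap d q => (acceptSet B ε q x).indicator
        (fun t : Trial d q => residual B (x + t.1)) (θ, f)) =
        {f | Accepts B ε q (x + θ) f}.indicator fun _ => residual B (x + θ) := by
      funext f
      by_cases h : Accepts B ε q (x + θ) f
      · rw [Set.indicator_of_mem (show (θ, f) ∈ acceptSet B ε q x from h),
          Set.indicator_of_mem (show f ∈ {f | Accepts B ε q (x + θ) f} from h)]
      · rw [Set.indicator_of_notMem (show (θ, f) ∉ acceptSet B ε q x from h),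
          Set.indicator_of_notMem (show f ∉ {f | Accepts B ε q (x + θ) f} from h)]
    rw [this, integral_indicator_const _ (Set.toFinite _).measurableSet]
    rfl
  simp only [hinner]
  rw [ProbabilityTheory.cond, integral_smul_measure,
    hB.setIntegral_voronoi_add hε (f := fun y => acceptProb B ε q y • residual B y)
      (fun l hl y => by rw [acceptProb_add hl, hB.residual_add hε hl]) x,
    setIntegral_voronoi_eq_zero_of_odd
      (fun y => by rw [acceptProb_neg, hB.residual_neg hε, smul_neg]), smul_zero]

end Trial

section Stopping

lemma sInf_setOf_eq_iff {p : ℕ → Prop} {n : ℕ} :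
    sInf {i | p i} = n ↔ ((∀ j < n, ¬ p j) ∧ p n) ∨ (n = 0 ∧ ∀ j, ¬ p j) := by
  constructor
  · rintro rfl
    by_cases h : ∃ j, p j
    · exact Or.inl ⟨fun j hj => Nat.notMem_of_lt_sInf hj, Nat.sInf_mem h⟩
    · push Not at h
      exact Or.inr ⟨by simp [h], h⟩
  · rintro (⟨h1, h2⟩ | ⟨rfl, h⟩)
    · refine le_antisymm (Nat.sInf_le h2) (le_csInf ⟨n, h2⟩ fun m hm => ?_)
      by_contra! hmn
      exact h1 m hmn hm
    · simp [h]

lemma measurable_sInf_setOf {α : Type*} [MeasurableSpace α] {E : ℕ → Set α}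
    (hE : ∀ i, MeasurableSet (E i)) : Measurable fun a => sInf {i | a ∈ E i} := by
  refine measurable_to_countable' fun n => ?_
  have : (fun a => sInf {i | a ∈ E i}) ⁻¹' {n} =
      ((⋂ j ∈ Set.Iio n, (E j)ᶜ) ∩ E n) ∪ ({_a | n = 0} ∩ ⋂ j, (E j)ᶜ) := by
    ext a
    rw [Set.mem_preimage, Set.mem_singleton_iff, sInf_setOf_eq_iff]
    simp
  rw [this]
  exact ((MeasurableSet.biInter (Set.to_countable _) fun j _ => (hE j).compl).inter (hE n)).union
    ((MeasurableSet.const _).inter (MeasurableSet.iInter fun j => (hE j).compl))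

variable {T : Type*} [MeasurableSpace T] {τ : Measure T} [IsProbabilityMeasure τ] {S : Set T}

lemma infinitePi_forall_lt_notMem (hS : MeasurableSet S) (N : ℕ) :
    Measure.infinitePi (fun _ : ℕ => τ) {t | ∀ i < N, t i ∉ S} = τ Sᶜ ^ N := by
  have := Measure.infinitePi_pi (fun _ : ℕ => τ) (s := Finset.range N) (t := fun _ => Sᶜ)
    fun _ _ => hS.compl
  rw [Finset.prod_const, Finset.card_range] at this
  rw [← this]
  congr 1
  ext t
  simp

/-- If a single trial succeeds with positive probability, then almost surely one of infinitely
many independent trials succeeds. -/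
lemma ae_infinitePi_exists_mem (hS : MeasurableSet S) (h : τ Sᶜ < 1) :
    ∀ᵐ t ∂(Measure.infinitePi fun _ : ℕ => τ), ∃ i, t i ∈ S := by
  rw [ae_iff]
  refine le_antisymm (ge_of_tendsto' (ENNReal.tendsto_pow_atTop_nhds_zero_of_lt_one h) fun N => ?_)
    zero_le
  rw [← infinitePi_forall_lt_notMem hS N]
  exact measure_mono fun t ht i _ hi => ht ⟨i, hi⟩

/-- Rejection sampling: a function whose mean over the accepted trials vanishes has mean zero at
the first accepted trial. -/
lemma integral_infinitePi_sInf_eq_zero {E : Type*} [NormedAddCommGroup E] [NormedSpace ℝ E]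
    [CompleteSpace E] [MeasurableSpace E] [BorelSpace E] [SecondCountableTopology E]
    (hS : MeasurableSet S) (h : τ Sᶜ < 1) {G : T → E} (hG : Measurable G) {c : ℝ}
    (hc : ∀ t, ‖G t‖ ≤ c) (h0 : ∫ t in S, G t ∂τ = 0) :
    ∫ t, G (t (sInf {i | t i ∈ S})) ∂(Measure.infinitePi fun _ : ℕ => τ) = 0 := by
  set ν := Measure.infinitePi fun _ : ℕ => τ with hν
  have hE : ∀ i : ℕ, MeasurableSet {t : ℕ → T | t i ∈ S} := fun i => measurable_pi_apply i hS
  have h_first : Measurable fun t : ℕ → T => sInf {i | t i ∈ S} := measurable_sInf_setOf hE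
  have hF : Measurable fun t : ℕ → T => G (t (sInf {i | t i ∈ S})) := by
    have : Measurable fun p : ℕ × (ℕ → T) => G (p.2 p.1) :=
      measurable_from_prod_countable_right fun i => hG.comp (measurable_pi_apply i)
    exact this.comp (h_first.prodMk measurable_id)
  have hFint : Integrable (fun t : ℕ → T => G (t (sInf {i | t i ∈ S}))) ν :=
    Integrable.of_bound hF.aestronglyMeasurable c (Filter.Eventually.of_forall fun t => hc _)
  let A : ℕ → Set (ℕ → T) := fun i => {t | ∀ j < i, t j ∉ S}
  let D : ℕ → Set (ℕ → T) := fun i => A i ∩ {t | t i ∈ S}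
  have hA : ∀ i, MeasurableSet (A i) := fun i => by
    have : A i = ⋂ j ∈ Set.Iio i, {t : ℕ → T | t j ∈ S}ᶜ := by ext; simp [A]
    rw [this]
    exact MeasurableSet.biInter (Set.to_countable _) fun j _ => (hE j).compl
  have hD : ∀ i, MeasurableSet (D i) := fun i => (hA i).inter (hE i)
  have hDstop : ∀ i, ∀ t ∈ D i, sInf {i | t i ∈ S} = i := fun i t ht =>
    sInf_setOf_eq_iff.2 (Or.inl ht)
  have hdisj : Pairwise (Function.onFun Disjoint D) := fun i j hij =>
    Set.disjoint_left.2 fun t hi hj => hij ((hDstop i t hi).symm.trans (hDstop j t hj))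
  have huniv : (⋃ i, D i : Set (ℕ → T)) =ᵐ[ν] Set.univ := by
    refine Filter.eventuallyEq_univ.2 ?_
    filter_upwards [ae_infinitePi_exists_mem hS h] with t ht
    refine Set.mem_iUnion.2 ⟨sInf {i | t i ∈ S}, fun j hj => Nat.notMem_of_lt_sInf hj,
      Nat.sInf_mem ht⟩
  rw [← setIntegral_univ, ← setIntegral_congr_set huniv,
    integral_iUnion hD hdisj hFint.integrableOn]
  refine (tsum_congr fun i => ?_).trans tsum_zero
  rw [setIntegral_congr_fun (g := fun t => G (t i)) (hD i)
    fun t ht => by simp only [hDstop i t ht]]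
  have hmeas : ∀ j : ℕ, Measurable fun t : ℕ → T => t j := fun j => measurable_pi_apply j
  have hind : IndepFun (fun t : ℕ → T => t i) (fun (t : ℕ → T) (j : Finset.range i) => t j) ν :=
    ((iIndepFun_infinitePi (P := fun _ : ℕ => τ) (X := fun _ t => t)
      fun _ => measurable_id).indepFun_finset {i} (Finset.range i) (by simp) hmeas).comp
        (measurable_pi_apply (⟨i, Finset.mem_singleton_self i⟩ : ({i} : Finset ℕ))) measurable_id
  have hY : StronglyMeasurable (S.indicator G) := (hG.indicator hS).stronglyMeasurable
  have hint : Integrable (fun t : ℕ → T => S.indicator G (t i)) ν :=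
    Integrable.of_bound (hY.comp_measurable (hmeas i)).aestronglyMeasurable c
      (Filter.Eventually.of_forall fun t => (norm_indicator_le_norm_self _ _).trans (hc _))
  have hmean : ∫ t, S.indicator G (t i) ∂ν = 0 := by
    rw [← h0, ← integral_indicator hS, ← Measure.infinitePi_map_eval (fun _ : ℕ => τ) i,
      integral_map (hmeas i).aemeasurable hY.aestronglyMeasurable]
  have hm₁ := (hmeas i).comap_le
  have hm₂ : MeasurableSpace.comap (fun (t : ℕ → T) (j : Finset.range i) => t j) inferInstance ≤
      MeasurableSpace.pi := Measurable.comap_le (measurable_pi_lambda _ fun j => hmeas j)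
  have hAi : MeasurableSet[MeasurableSpace.comap (fun (t : ℕ → T) (j : Finset.range i) => t j)
      inferInstance] (A i) := by
    refine ⟨⋂ j : Finset.range i, {u | u j ∉ S}, MeasurableSet.iInter fun j =>
      show MeasurableSet ((fun u : Finset.range i → T => u j) ⁻¹' Sᶜ) from
        (measurable_pi_apply j) hS.compl, ?_⟩
    ext t
    simp [A]
  have hcond := condExp_indep_eq hm₁ hm₂
    (hY.comp_measurable (comap_measurable fun t : ℕ → T => t i)) ((IndepFun_iff_Indep _ _ _).1 hind)
  calc ∫ t in D i, G (t i) ∂ν = ∫ t in A i, S.indicator G (t i) ∂ν := by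
        rw [← setIntegral_indicator (hE i)]
        rfl
    _ = ∫ t in A i, (ν[fun t => S.indicator G (t i) | MeasurableSpace.comap
          (fun (t : ℕ → T) (j : Finset.range i) => t j) inferInstance]) t ∂ν :=
        (setIntegral_condExp hm₂ hint hAi).symm
    _ = ∫ t in A i, (0 : E) ∂ν := by
        refine setIntegral_congr_ae (hA i) ?_
        filter_upwards [hcond] with t ht _
        exact ht.trans hmean
    _ = 0 := by simp

end Stopping

section Bits

lemma bitsToNat_bits (i : ℕ) : bitsToNat i.bits = i := by
  induction i using Nat.binaryRec' with
  | zero => simp [bitsToNat]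
  | bit b n h ih =>
    rw [Nat.bits_append_bit n b h]
    simpa [bitsToNat] using congrArg (Nat.bit b) ih

lemma bitsToNat_ofFn_testBit (w c : ℕ) (h : c < 2 ^ w) :
    bitsToNat (List.ofFn fun j : Fin w => c.testBit j) = c := by
  induction w generalizing c with
  | zero =>
    have : c = 0 := by simpa using h
    simp [bitsToNat, this]
  | succ w ih =>
    have h2 : c / 2 < 2 ^ w := by rw [pow_succ] at h; omega
    have := ih (c / 2) h2
    simp only [List.ofFn_succ, bitsToNat, List.foldr_cons, Fin.val_succ, Nat.testBit_succ,
      Fin.val_zero] at this ⊢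
    rw [this, Nat.bit_val, Nat.testBit_zero]
    rcases Nat.mod_two_eq_zero_or_one c with h0 | h0 <;> simp [h0] <;> omega

lemma take_bitString (w c i : ℕ) :
    (bitString w c i).take w = List.ofFn fun j : Fin w => c.testBit j := by
  rw [bitString, List.take_left']; simp

lemma drop_bitString (w c i : ℕ) : (bitString w c i).drop w = i.bits := by
  rw [bitString, List.drop_left']; simp

lemma length_bitString (w c i : ℕ) : (bitString w c i).length = w + i.size := by
  rw [bitString, List.length_append, List.length_ofFn, Nat.size_eq_bits_len]

end Bits

section Decode

variable {d : ℕ} {B : Module.Basis (Fin d) ℝ (Vec d)} {ε q : ℝ} {x xv : Vec d}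
  {t : ℕ → Trial d q}

/-- The index of the first accepted trial. -/
noncomputable def firstAccept (B : Module.Basis (Fin d) ℝ (Vec d)) (ε q : ℝ) (x : Vec d)
    (t : ℕ → Trial d q) : ℕ :=
  sInf {i | t i ∈ acceptSet B ε q x}

/-- The trials for which no shifted input lies on the boundary of a Voronoi region and one trial is
accepted. -/
def regularSet (B : Module.Basis (Fin d) ℝ (Vec d)) (ε q : ℝ) : Set (Vec d × (ℕ → Trial d q)) :=
  {p | (∀ i, ∃ z ∈ lattice B, p.1 + (p.2 i).1 ∈ voronoi B z) ∧
    ∃ i, p.2 i ∈ acceptSet B ε q p.1}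

lemma IsEpsLattice.successful_iff (hB : IsEpsLattice B ε) (hε : 0 < ε)
    (ht : (x, t) ∈ regularSet B ε q) (i : ℕ) :
    Successful B ε q (t i) x ↔ t i ∈ acceptSet B ε q x := by
  obtain ⟨z, hz, hx⟩ := ht.1 i
  exact hB.accepts_iff hε hz hx

lemma IsEpsLattice.stopIndex_eq (hB : IsEpsLattice B ε) (hε : 0 < ε)
    (ht : (x, t) ∈ regularSet B ε q) : stopIndex B ε q t x = firstAccept B ε q x t := by
  simp only [stopIndex, firstAccept, hB.successful_iff hε ht]

lemma color_lt_two_pow (s : Trial d q) (z : Vec d) :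
    (color B q s z : ℕ) < 2 ^ colorWidth d q :=
  (color B q s z).2.trans_le (Nat.le_pow_clog one_lt_two _)

/-- A machine whose input is within `q ε` of the input of the source decodes to the rounded point
of the source. -/
lemma IsEpsLattice.decode_encode (hB : IsEpsLattice B ε) (hε : 0 < ε)
    (ht : (x, t) ∈ regularSet B ε q) (hv : ‖xv - x‖ ≤ q * ε) :
    decode B ε q t (encode B ε q t x) xv =
      x + residual B (x + (t (firstAccept B ε q x t)).1) := by
  have h_first := hB.stopIndex_eq hε ht
  have hacc : t (firstAccept B ε q x t) ∈ acceptSet B ε q x := Nat.sInf_mem ht.2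
  have hdrop : bitsToNat ((encode B ε q t x).drop (colorWidth d q)) = firstAccept B ε q x t := by
    rw [encode, drop_bitString, bitsToNat_bits, h_first]
  have htake : bitsToNat ((encode B ε q t x).take (colorWidth d q)) =
      color B q (t (firstAccept B ε q x t)) (rounded B (t (firstAccept B ε q x t)) x) := by
    rw [encode, take_bitString, bitsToNat_ofFn_testBit _ _ (color_lt_two_pow _ _), h_first]
  rw [decode, hdrop, htake]
  generalize t (firstAccept B ε q x t) = s at hacc
  obtain ⟨z, hz, hyz, hsep⟩ := hacc
  have hr : rounded B s x = z := hB.closestPoint_eq hε hz hyz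
  rw [hr, hB.residual_eq hε hz hyz]
  have hex : ∃ w ∈ lattice B, (Metric.closedBall (xv + s.1) (q * ε) ∩ voronoi B w).Nonempty ∧
      (color B q s w : ℕ) = color B q s z :=
    ⟨z, hz, ⟨x + s.1, by
      rwa [Metric.mem_closedBall, dist_eq_norm, add_sub_add_right_eq_sub, norm_sub_rev], hyz⟩, rfl⟩
  rw [dif_pos hex]
  obtain ⟨hw, ⟨p, hp, hpw⟩, hcol⟩ := hex.choose_spec
  have hwz : hex.choose = z := by
    by_contra hne
    refine hsep _ hw hne ⟨p, hpw, ?_⟩ (Fin.ext hcol).symm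
    rw [Metric.mem_closedBall, dist_eq_norm] at hp
    calc ‖x + s.1 - p‖ = ‖(xv - x) + (p - (xv + s.1))‖ := by
          rw [← norm_neg]; congr 1; abel
      _ ≤ ‖xv - x‖ + ‖p - (xv + s.1)‖ := norm_add_le _ _
      _ ≤ 2 * q * ε := by linarith
  rw [hwz]
  abel

lemma IsEpsLattice.length_encode (hB : IsEpsLattice B ε) (hε : 0 < ε)
    (ht : (x, t) ∈ regularSet B ε q) :
    (encode B ε q t x).length = colorWidth d q + (firstAccept B ε q x t).size := by
  rw [encode, length_bitString, hB.stopIndex_eq hε ht]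

end Decode

section Tree

variable {n d : ℕ} {B : Module.Basis (Fin d) ℝ (Vec d)} {ε q : ℝ}

lemma treePos_injective (u : Fin n) : Function.Injective (treePos u) := by
  intro v w h
  have hv := v.2
  have hw := w.2
  have hu := u.2
  unfold treePos at h
  have key : ∀ m : Fin n, ((m : ℕ) + n - u) % n = if (u : ℕ) ≤ m then (m : ℕ) - u
      else (m : ℕ) + n - u := by
    intro m
    have hm := m.2
    split_ifs with hum
    · rw [show (m : ℕ) + n - u = (m - u) + n by omega, Nat.add_mod_right,
        Nat.mod_eq_of_lt (by omega)]
    · exact Nat.mod_eq_of_lt (by omega)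
  rw [key, key] at h
  ext
  split_ifs at h <;> omega

lemma ncard_children_le (u v : Fin n) : {w | Forwards u v w}.ncard ≤ 2 := by
  have h : {w | Forwards u v w} ⊆ treePos u ⁻¹' {2 * treePos u v + 1, 2 * treePos u v + 2} := by
    rintro w ⟨h0, h1⟩
    rw [Set.mem_preimage, Set.mem_insert_iff, Set.mem_singleton_iff]
    omega
  calc {w | Forwards u v w}.ncard
      ≤ ({2 * treePos u v + 1, 2 * treePos u v + 2} : Set ℕ).ncard :=
        Set.ncard_le_ncard_of_injOn (treePos u) (fun w hw => h hw) (treePos_injective u).injOn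
    _ ≤ 2 := (Set.ncard_insert_le _ _).trans (by simp)

lemma ncard_parents_le (u v : Fin n) : {w | Forwards u w v}.ncard ≤ 1 := by
  refine Set.ncard_le_one (Set.toFinite _) |>.2 fun a ha b hb => treePos_injective u ?_
  rw [ha.2, hb.2]

lemma bitsUsed_le (x : Fin n → Vec d) (r : Coins n d q) (v : Fin n) :
    bitsUsed B ε q x r v ≤ 3 * (message B ε q x r).length :=
  Nat.mul_le_mul_right _ (Nat.add_le_add (ncard_children_le r.1 v) (ncard_parents_le r.1 v))

end Tree

section Coins

variable {n d : ℕ} {B : Module.Basis (Fin d) ℝ (Vec d)} {ε q : ℝ}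

lemma IsEpsLattice.isProbabilityMeasure_coin [NeZero n] [Fact (0 < q)] (hB : IsEpsLattice B ε)
    (hε : 0 < ε) : IsProbabilityMeasure (coinMeasure n B q) := by
  have := hB.isProbabilityMeasure_trial (q := q) hε
  have : IsProbabilityMeasure (uniformOn Set.univ : Measure (Fin n)) :=
    isProbabilityMeasure_uniformOn Set.finite_univ Set.univ_nonempty
  rw [coinMeasure]; infer_instance

/-- The error of the decoded point, as a function of the input of the source. -/
noncomputable def decodeError (B : Module.Basis (Fin d) ℝ (Vec d)) (ε q : ℝ)
    (p : Vec d × (ℕ → Trial d q)) : Vec d :=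
  residual B (p.1 + (p.2 (firstAccept B ε q p.1 p.2)).1)

lemma measurable_shift (i : ℕ) :
    Measurable fun p : Vec d × (ℕ → Trial d q) => (p.1 + (p.2 i).1, (p.2 i).2) := by
  have h : Measurable fun p : Vec d × (ℕ → Trial d q) => p.2 i :=
    (measurable_pi_apply i).comp measurable_snd
  exact (measurable_fst.add h.fst).prodMk h.snd

lemma IsEpsLattice.measurableSet_mem_acceptSet [Fact (0 < q)] (hB : IsEpsLattice B ε)
    (hε : 0 < ε) (i : ℕ) :
    MeasurableSet {p : Vec d × (ℕ → Trial d q) | p.2 i ∈ acceptSet B ε q p.1} :=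
  measurable_shift i (hB.measurableSet_accepts hε)

lemma IsEpsLattice.measurable_firstAccept [Fact (0 < q)] (hB : IsEpsLattice B ε) (hε : 0 < ε) :
    Measurable fun p : Vec d × (ℕ → Trial d q) => firstAccept B ε q p.1 p.2 :=
  measurable_sInf_setOf (hB.measurableSet_mem_acceptSet hε)

lemma IsEpsLattice.measurable_decodeError [Fact (0 < q)] (hB : IsEpsLattice B ε) (hε : 0 < ε) :
    Measurable (decodeError B ε q) := by
  let F : ℕ × (Vec d × (ℕ → Trial d q)) → Vec d := fun p => residual B (p.2.1 + (p.2.2 p.1).1)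
  have hF : Measurable F := measurable_from_prod_countable_right fun i => by
    have : Measurable fun p : Vec d × (ℕ → Trial d q) => residual B (p.1 + (p.2 i).1) :=
      (hB.measurable_residual hε).comp (measurable_shift i).fst
    exact this
  have h : decodeError B ε q = F ∘ fun p => (firstAccept B ε q p.1 p.2, p) := by
    funext p; rfl
  rw [h]
  exact hF.comp ((hB.measurable_firstAccept hε).prodMk measurable_id)

lemma IsEpsLattice.measurableSet_regularSet [Fact (0 < q)] (hB : IsEpsLattice B ε) (hε : 0 < ε) :
    MeasurableSet (regularSet B ε q) := by
  have : regularSet B ε q =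
      (⋂ i, {p | ∃ z ∈ lattice B, p.1 + (p.2 i).1 ∈ voronoi B z}) ∩
        ⋃ i, {p | p.2 i ∈ acceptSet B ε q p.1} := by
    ext p
    simp [regularSet]
  rw [this]
  exact (MeasurableSet.iInter fun i =>
    (measurable_shift i).fst (hB.measurableSet_exists_mem_voronoi hε)).inter
    (MeasurableSet.iUnion fun i => hB.measurableSet_mem_acceptSet hε i)

lemma IsEpsLattice.trialMeasure_compl_acceptSet_lt_one [hq : Fact (0 < q)] (hB : IsEpsLattice B ε)
    (hε : 0 < ε) (hd : 1 ≤ d) (x : Vec d) : trialMeasure B q (acceptSet B ε q x)ᶜ < 1 := by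
  have hq0 := hq.out
  refine (hB.trialMeasure_compl_acceptSet_le hε x).trans_lt ?_
  rw [ENNReal.ofReal_lt_one]
  exact inv_lt_one_of_one_lt₀ (one_lt_pow₀ (by linarith) (by omega))

lemma IsEpsLattice.ae_mem_regularSet [Fact (0 < q)] (hB : IsEpsLattice B ε) (hε : 0 < ε)
    (hd : 1 ≤ d) (x : Vec d) :
    ∀ᵐ t ∂(Measure.infinitePi fun _ : ℕ => trialMeasure B q), (x, t) ∈ regularSet B ε q := by
  have := hB.isProbabilityMeasure_trial (q := q) hε
  have h1 : ∀ᵐ t ∂(Measure.infinitePi fun _ : ℕ => trialMeasure B q),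
      ∀ i, ∃ z ∈ lattice B, x + (t i).1 ∈ voronoi B z :=
    ae_all_iff.2 fun i => (measurePreserving_eval_infinitePi (fun _ : ℕ => trialMeasure B q)
      i).quasiMeasurePreserving.ae (hB.ae_trial_exists_mem_voronoi hε x)
  filter_upwards [h1, ae_infinitePi_exists_mem (hB.measurableSet_acceptSet hε)
    (hB.trialMeasure_compl_acceptSet_lt_one hε hd x)] with t h2 h3
  exact ⟨h2, h3⟩

lemma IsEpsLattice.integral_decodeError [Fact (0 < q)] (hB : IsEpsLattice B ε) (hε : 0 < ε)
    (hd : 1 ≤ d) (x : Vec d) :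
    ∫ t, decodeError B ε q (x, t) ∂(Measure.infinitePi fun _ : ℕ => trialMeasure B q) = 0 := by
  have := hB.isProbabilityMeasure_trial (q := q) hε
  exact integral_infinitePi_sInf_eq_zero (hB.measurableSet_acceptSet hε)
    (hB.trialMeasure_compl_acceptSet_lt_one hε hd x)
    ((hB.measurable_residual hε).comp (measurable_fst.const_add x))
    (fun t => hB.norm_residual_le hε _) (hB.setIntegral_acceptSet_residual hε x)

end Coins

section Source

variable {n d : ℕ} {Ω T E : Type*} [MeasurableSpace Ω] [MeasurableSpace T]
  {P : Measure Ω} {ν : Measure T}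

/-- The distribution of the inputs, a uniformly random machine and further randomness. -/
noncomputable abbrev sourceMeasure (n : ℕ) (P : Measure Ω) (ν : Measure T) :
    Measure (Ω × Fin n × T) :=
  P.prod ((uniformOn Set.univ).prod ν)

instance [NeZero n] : IsProbabilityMeasure (uniformOn Set.univ : Measure (Fin n)) :=
  isProbabilityMeasure_uniformOn Set.finite_univ Set.univ_nonempty

lemma measurable_select {α : Type*} [MeasurableSpace α] {X : Fin n → Ω → α}
    (hX : ∀ v, Measurable (X v)) : Measurable fun p : Ω × Fin n × T => (X p.2.1 p.1, p.2.2) := by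
  have : Measurable fun p : Ω × Fin n => X p.2 p.1 :=
    measurable_from_prod_countable_left hX
  exact (this.comp (measurable_fst.prodMk measurable_snd.fst)).prodMk measurable_snd.snd

/-- An event with small probability for each input has small probability. -/
lemma sourceMeasure_preimage_le [IsProbabilityMeasure P] [IsProbabilityMeasure ν] [NeZero n]
     {α : Type*} [MeasurableSpace α] {X : Fin n → Ω → α} (hX : ∀ v, Measurable (X v)) {s : Set (α × T)} (hs : MeasurableSet s) {c : ENNReal}
    (h : ∀ x, ν (Prod.mk x ⁻¹' s) ≤ c) :
    sourceMeasure n P ν ((fun p => (X p.2.1 p.1, p.2.2)) ⁻¹' s) ≤ c := by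
  have hm := measurable_select (T := T) hX hs
  rw [sourceMeasure, Measure.prod_apply hm]
  refine (lintegral_mono fun ω => ?_).trans (by simp : ∫⁻ _ : Ω, c ∂P ≤ c)
  rw [Measure.prod_apply (measurable_prodMk_left hm)]
  exact (lintegral_mono fun u => h (X u ω)).trans (by simp)

lemma ae_sourceMeasure [SFinite ν] {X X' : Fin n → Ω → E} (h : ∀ v, X v =ᵐ[P] X' v) :
    ∀ᵐ p ∂(sourceMeasure n P ν), ∀ v, X v p.1 = X' v p.1 :=
  Measure.quasiMeasurePreserving_fst.ae (ae_all_iff.2 h)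

lemma memLp_select [NormedAddCommGroup E] [IsProbabilityMeasure ν] [NeZero n] {X : Fin n → Ω → E} {r : ENNReal} (hX : ∀ v, MemLp (X v) r P) :
    MemLp (fun p : Ω × Fin n × T => X p.2.1 p.1) r (sourceMeasure n P ν) := by
  have h : (fun p : Ω × Fin n × T => X p.2.1 p.1) = fun p => ∑ v,
      ({p : Ω × Fin n × T | p.2.1 = v}.indicator fun p => X v p.1) p := by
    funext p
    rw [Finset.sum_eq_single p.2.1 (fun v _ hv => Set.indicator_of_notMem (fun h => hv h.symm) _)
      (by simp), Set.indicator_of_mem (by rfl)]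
  rw [h]
  refine memLp_finsetSum _ fun v _ => MemLp.indicator ?_ ?_
  · exact measurable_snd.fst (measurableSet_singleton v)
  · exact (hX v).comp_measurePreserving measurePreserving_fst

lemma integral_select [IsProbabilityMeasure P] [IsProbabilityMeasure ν] [NeZero n]
    [NormedAddCommGroup E] [NormedSpace ℝ E] [CompleteSpace E] {X : Fin n → Ω → E}
    (hX : ∀ v, Integrable (X v) P) :
    ∫ p, X p.2.1 p.1 ∂(sourceMeasure n P ν) = (n : ℝ)⁻¹ • ∑ v, ∫ ω, X v ω ∂P := by
  have hint : Integrable (fun p : Ω × Fin n × T => X p.2.1 p.1) (sourceMeasure n P ν) :=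
    memLp_one_iff_integrable.1 (memLp_select fun v => memLp_one_iff_integrable.2 (hX v))
  rw [integral_prod _ hint]
  have hinner : ∀ ω, ∫ r : Fin n × T, X r.1 ω ∂((uniformOn Set.univ).prod ν) =
      (n : ℝ)⁻¹ • ∑ v, X v ω := by
    intro ω
    rw [integral_fun_fst (fun u => X u ω), probReal_univ, one_smul,
      integral_fintype Integrable.of_finite, Finset.smul_sum]
    refine Finset.sum_congr rfl fun v _ => ?_
    congr 1
    rw [Measure.real, uniformOn_univ, Measure.count_singleton]
    simp
  simp only [hinner]
  rw [integral_smul, integral_finsetSum _ fun v _ => hX v]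

end Source

section Bounds

lemma exp_le_two_rpow {x : ℝ} (hx : 0 ≤ x) : Real.exp x ≤ 2 ^ (2 * x) := by
  rw [Real.rpow_def_of_pos two_pos]
  refine Real.exp_le_exp.2 ?_
  nlinarith [Real.log_two_gt_d9]

lemma colorWidth_le (d : ℕ) {q : ℝ} (hq : 0 < q) : (colorWidth d q : ℝ) ≤ 12 * (d * q) + 1 := by
  have h0 : 0 ≤ 12 * (d * q) := by positivity
  refine le_trans ?_ (Nat.ceil_lt_add_one h0).le
  rw [Nat.cast_le, colorWidth]
  refine Nat.clog_le_of_le_pow (Nat.ceil_le.2 ?_)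
  calc (1 + 2 * q) ^ (3 * d) ≤ Real.exp (2 * q) ^ (3 * d) := by
        gcongr; linarith [Real.add_one_le_exp (2 * q)]
    _ = Real.exp (6 * (d * q)) := by rw [← Real.exp_nat_mul]; push_cast; ring_nf
    _ ≤ (2 : ℝ) ^ (2 * (6 * (d * q))) := exp_le_two_rpow (by positivity)
    _ ≤ (2 : ℝ) ^ ((⌈12 * (d * q)⌉₊ : ℕ) : ℝ) := by
        refine Real.rpow_le_rpow_of_exponent_le one_le_two ?_
        linarith [Nat.le_ceil (12 * (d * q))]
    _ = ((2 ^ ⌈12 * (d * q)⌉₊ : ℕ) : ℝ) := by rw [Real.rpow_natCast]; norm_cast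

lemma pow_two_pow_le {s p : ℝ} (hs : 0 ≤ s) (hp0 : 0 ≤ p) (hp : p ≤ 2⁻¹) :
    p ^ 2 ^ ⌈3 * s⌉₊ ≤ (2 : ℝ) ^ ((1 - s) * 2 ^ s) := by
  calc p ^ 2 ^ ⌈3 * s⌉₊ ≤ (2⁻¹ : ℝ) ^ 2 ^ ⌈3 * s⌉₊ := by gcongr
    _ = (2 : ℝ) ^ (-((2 : ℝ) ^ ((⌈3 * s⌉₊ : ℕ) : ℝ))) := by
        rw [inv_pow, Real.rpow_neg zero_le_two, ← Real.rpow_natCast, Real.rpow_natCast]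
        norm_cast
    _ ≤ (2 : ℝ) ^ ((1 - s) * 2 ^ s) := by
        refine Real.rpow_le_rpow_of_exponent_le one_le_two ?_
        have h1 : (2 : ℝ) ^ (3 * s) ≤ (2 : ℝ) ^ ((⌈3 * s⌉₊ : ℕ) : ℝ) :=
          Real.rpow_le_rpow_of_exponent_le one_le_two (Nat.le_ceil _)
        have h2 : (2 : ℝ) ^ (3 * s) = 2 ^ (2 * s) * 2 ^ s := by
          rw [← Real.rpow_add two_pos]; ring_nf
        have h3 := exp_le_two_rpow hs
        have h4 := Real.add_one_le_exp s
        have h5 : (0 : ℝ) < 2 ^ s := by positivity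
        nlinarith

lemma inv_pow_le_half {d : ℕ} {q : ℝ} (hq : 0 < q) (h : 1 ≤ d * q) :
    ((1 + 2 * q) ^ (2 * d))⁻¹ ≤ 2⁻¹ := by
  refine inv_anti₀ two_pos ?_
  have := one_add_mul_le_pow (a := 2 * q) (by linarith) (2 * d)
  push_cast at this
  nlinarith

end Bounds

section Main

variable {n d : ℕ} {B : Module.Basis (Fin d) ℝ (Vec d)} {ε q : ℝ} {Ω : Type*} [MeasurableSpace Ω]
  {P : Measure Ω} [IsProbabilityMeasure P] {X : Fin n → Ω → Vec d}

lemma IsEpsLattice.ae_select_mem_regularSet [NeZero n] [Fact (0 < q)]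
    (hB : IsEpsLattice B ε) (hε : 0 < ε) (hd : 1 ≤ d) (hX : ∀ v, AEStronglyMeasurable (X v) P) :
    ∀ᵐ p ∂(P.prod (coinMeasure n B q)), (X p.2.1 p.1, p.2.2) ∈ regularSet B ε q := by
  have := hB.isProbabilityMeasure_trial (q := q) hε
  have h := sourceMeasure_preimage_le (P := P)
    (ν := Measure.infinitePi fun _ : ℕ => trialMeasure B q)
    (fun v => (hX v).stronglyMeasurable_mk.measurable) (hB.measurableSet_regularSet hε).compl
    (c := 0) fun x => (hB.ae_mem_regularSet hε hd x : _).le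
  have h0 := measure_eq_zero_iff_ae_notMem.1 (le_antisymm h zero_le)
  filter_upwards [h0, ae_sourceMeasure fun v => (hX v).ae_eq_mk] with p hp hp'
  rw [hp']
  exact not_not.1 hp

/-- The output of the source is its input plus the error of the decoded point. -/
lemma IsEpsLattice.ae_output_eq [NeZero n] [Fact (0 < q)]
    (hB : IsEpsLattice B ε) (hε : 0 < ε) (hd : 1 ≤ d) (hX : ∀ v, AEStronglyMeasurable (X v) P) :
    ∀ᵐ p ∂(P.prod (coinMeasure n B q)), ∀ v, ‖X v p.1 - X p.2.1 p.1‖ ≤ q * ε →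
      output B ε q (fun v => X v p.1) p.2 v =
        X p.2.1 p.1 + decodeError B ε q (X p.2.1 p.1, p.2.2) := by
  filter_upwards [hB.ae_select_mem_regularSet hε hd hX] with p hp v hv
  exact hB.decode_encode hε hp hv

lemma IsEpsLattice.ae_terminates [NeZero n] [Fact (0 < q)]
    (hB : IsEpsLattice B ε) (hε : 0 < ε) (hd : 1 ≤ d) (hX : ∀ v, AEStronglyMeasurable (X v) P) :
    ∀ᵐ p ∂(P.prod (coinMeasure n B q)), Terminates B ε q (fun v => X v p.1) p.2 := by
  filter_upwards [hB.ae_select_mem_regularSet hε hd hX] with p hp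
  obtain ⟨i, hi⟩ := hp.2
  exact ⟨i, (hB.successful_iff hε hp i).2 hi⟩

/-- With high probability every machine sends and receives few bits. -/
lemma IsEpsLattice.measure_bitsUsed_le [NeZero n] [hq : Fact (0 < q)]
    (hB : IsEpsLattice B ε) (hε : 0 < ε) (hd : 1 ≤ d) (hX : ∀ v, AEStronglyMeasurable (X v) P)
    {C : ℝ} (hC : 51 ≤ C) :
    P.prod (coinMeasure n B q)
        {p | ∃ v, C * d * q < bitsUsed B ε q (fun v => X v p.1) p.2 v} ≤
      ENNReal.ofReal ((2 : ℝ) ^ ((1 - d * q) * (2 : ℝ) ^ ((d : ℝ) * q))) := by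
  have := hB.isProbabilityMeasure_trial (q := q) hε
  have := hB.isProbabilityMeasure_coin (n := n) (q := q) hε
  have hq0 := hq.out
  have hs0 : 0 ≤ d * q := by positivity
  rcases le_total (d * q) 1 with h1 | h1
  · refine prob_le_one.trans ?_
    rw [ENNReal.one_le_ofReal]
    exact Real.one_le_rpow one_le_two (mul_nonneg (by linarith) (by positivity))
  set k := ⌈3 * (d * q)⌉₊ with hk
  let s : Set (Vec d × (ℕ → Trial d q)) := {p | ∀ i < 2 ^ k, p.2 i ∉ acceptSet B ε q p.1}
  have hs : MeasurableSet s := by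
    have : s = ⋂ i ∈ Set.Iio (2 ^ k), {p | p.2 i ∈ acceptSet B ε q p.1}ᶜ := by ext; simp [s]
    rw [this]
    exact MeasurableSet.biInter (Set.to_countable _) fun i _ =>
      (hB.measurableSet_mem_acceptSet hε i).compl
  have hle := sourceMeasure_preimage_le (P := P)
    (ν := Measure.infinitePi fun _ : ℕ => trialMeasure B q)
    (fun v => (hX v).stronglyMeasurable_mk.measurable) hs
    (c := ENNReal.ofReal ((2 : ℝ) ^ ((1 - d * q) * (2 : ℝ) ^ ((d : ℝ) * q)))) fun x => by
      have h := infinitePi_forall_lt_notMem (τ := trialMeasure B q)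
        (hB.measurableSet_acceptSet (x := x) hε) (2 ^ k)
      rw [show Prod.mk x ⁻¹' s = {t | ∀ i < 2 ^ k, t i ∉ acceptSet B ε q x} by
        ext t; exact Iff.rfl, h]
      calc trialMeasure B q (acceptSet B ε q x)ᶜ ^ 2 ^ k
          ≤ ENNReal.ofReal (((1 + 2 * q) ^ (2 * d))⁻¹) ^ 2 ^ k := by
            gcongr; exact hB.trialMeasure_compl_acceptSet_le hε x
        _ = ENNReal.ofReal ((((1 + 2 * q) ^ (2 * d))⁻¹) ^ 2 ^ k) :=
            (ENNReal.ofReal_pow (by positivity) _).symm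
        _ ≤ _ := ENNReal.ofReal_le_ofReal
            (pow_two_pow_le hs0 (by positivity) (inv_pow_le_half hq0 h1))
  refine le_trans (measure_mono_ae ?_) hle
  filter_upwards [hB.ae_select_mem_regularSet hε hd hX,
    ae_sourceMeasure fun v => (hX v).ae_eq_mk] with p hp hp' hbits
  obtain ⟨v, hv⟩ := hbits
  show ∀ i < 2 ^ k, p.2.2 i ∉ acceptSet B ε q ((hX p.2.1).mk _ p.1)
  rw [← hp']
  intro i hi hacc
  have hfirst : firstAccept B ε q (X p.2.1 p.1) p.2.2 < 2 ^ k := (Nat.sInf_le hacc).trans_lt hi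
  have hlen : ((message B ε q (fun v => X v p.1) p.2).length : ℝ) ≤ 17 * (d * q) := by
    rw [message, hB.length_encode hε hp, Nat.cast_add]
    have h2 : ((firstAccept B ε q (X p.2.1 p.1) p.2.2).size : ℝ) ≤ k := by
      exact_mod_cast Nat.size_le.2 hfirst
    have h3 := colorWidth_le d hq0
    have h4 := Nat.ceil_lt_add_one (show 0 ≤ 3 * (d * q) by positivity)
    rw [← hk] at h4
    linarith
  have hused : (bitsUsed B ε q (fun v => X v p.1) p.2 v : ℝ) ≤
      3 * (message B ε q (fun v => X v p.1) p.2).length := by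
    exact_mod_cast bitsUsed_le _ _ _
  have : 51 * (d * q) ≤ C * (d * q) := by gcongr
  linarith

/-- With high probability all inputs are so close that all machines output the same value. -/
lemma IsEpsLattice.measure_output_ne_le [NeZero n] [hq : Fact (0 < q)]
    (hB : IsEpsLattice B ε) (hε : 0 < ε) (hd : 1 ≤ d) (hX : ∀ v, MemLp (X v) 2 P) {g : Vec d}
    {σ α : ℝ} (hσ : 0 < σ) (hα : 1 < α) (hqε : q * ε = 2 * (σ * √(α * n)))
    (hvar : ∀ v, ∫ ω, ‖X v ω - g‖ ^ 2 ∂P ≤ σ ^ 2) :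
    P.prod (coinMeasure n B q) {p | ∃ v, output B ε q (fun v => X v p.1) p.2 v ≠
        output B ε q (fun v => X v p.1) p.2 p.2.1} ≤ ENNReal.ofReal (1 / α) := by
  have := hB.isProbabilityMeasure_coin (n := n) (q := q) hε
  have hn : (0 : ℝ) < n := by exact_mod_cast Nat.pos_of_ne_zero (NeZero.ne n)
  have hr : 0 < σ ^ 2 * (α * n) := by positivity
  have hfar : ∀ v, P {ω | σ ^ 2 * (α * n) ≤ ‖X v ω - g‖ ^ 2} ≤ ENNReal.ofReal (1 / (α * n)) := by
    intro v
    have hint : Integrable (fun ω => ‖X v ω - g‖ ^ 2) P :=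
      ((hX v).sub (memLp_const g)).integrable_norm_pow two_ne_zero
    have h := mul_meas_ge_le_integral_of_nonneg (Filter.Eventually.of_forall fun ω => by positivity)
      hint (σ ^ 2 * (α * n))
    rw [← ofReal_measureReal]
    refine ENNReal.ofReal_le_ofReal ?_
    rw [le_div_iff₀ (by positivity)]
    have h2 := h.trans (hvar v)
    have hσ2 : 0 < σ ^ 2 := by positivity
    refine le_of_mul_le_mul_left ?_ hσ2
    linarith
  calc P.prod (coinMeasure n B q) {p | ∃ v, output B ε q (fun v => X v p.1) p.2 v ≠
        output B ε q (fun v => X v p.1) p.2 p.2.1}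
      ≤ P.prod (coinMeasure n B q)
        (⋃ v, {ω | σ ^ 2 * (α * n) ≤ ‖X v ω - g‖ ^ 2} ×ˢ Set.univ) := by
        refine measure_mono_ae ?_
        filter_upwards [hB.ae_output_eq hε hd fun v => (hX v).1] with p hp hne
        obtain ⟨v, hv⟩ := hne
        by_contra hall
        have hall' : ∀ w, ‖X w p.1 - g‖ ≤ σ * √(α * n) := by
          intro w
          have hw : p ∉ {ω | σ ^ 2 * (α * n) ≤ ‖X w ω - g‖ ^ 2} ×ˢ Set.univ :=
            fun h => hall (Set.mem_iUnion.2 ⟨w, h⟩)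
          have hw' : ‖X w p.1 - g‖ ^ 2 < σ ^ 2 * (α * n) := by
            by_contra! h
            exact hw ⟨h, trivial⟩
          refine abs_le_of_sq_le_sq' ?_ (by positivity) |>.2
          rw [mul_pow, Real.sq_sqrt (by positivity)]
          exact hw'.le
        refine hv ?_
        rw [hp v, hp p.2.1]
        · rw [sub_self, norm_zero]
          rw [hqε]; positivity
        · rw [hqε]
          calc ‖X v p.1 - X p.2.1 p.1‖ = ‖(X v p.1 - g) - (X p.2.1 p.1 - g)‖ := by
                rw [sub_sub_sub_cancel_right]
            _ ≤ ‖X v p.1 - g‖ + ‖X p.2.1 p.1 - g‖ := norm_sub_le _ _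
            _ ≤ 2 * (σ * √(α * n)) := by linarith [hall' v, hall' p.2.1]
    _ ≤ ∑ v, P.prod (coinMeasure n B q)
          ({ω | σ ^ 2 * (α * n) ≤ ‖X v ω - g‖ ^ 2} ×ˢ Set.univ) := measure_iUnion_fintype_le _ _
    _ ≤ ∑ _v : Fin n, ENNReal.ofReal (1 / (α * n)) := by
        refine Finset.sum_le_sum fun v _ => ?_
        rw [Measure.prod_prod, measure_univ, mul_one]
        exact hfar v
    _ = ENNReal.ofReal (1 / α) := by
        rw [Finset.sum_const, Finset.card_univ, Fintype.card_fin, ← ENNReal.ofReal_nsmul]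
        congr 1
        rw [nsmul_eq_mul]
        field_simp

/-- The output of the source is an unbiased estimate with small variance. -/
lemma IsEpsLattice.output_source_unbiased [NeZero n] [hq : Fact (0 < q)]
    (hB : IsEpsLattice B ε) (hε : 0 < ε) (hd : 1 ≤ d) (hX : ∀ v, MemLp (X v) 2 P) {g : Vec d}
    {σ : ℝ} (hmean : ∀ v, ∫ ω, X v ω ∂P = g)
    (hvar : ∀ v, ∫ ω, ‖X v ω - g‖ ^ 2 ∂P ≤ σ ^ 2) {EST : Ω × Coins n d q → Vec d}
    (hEST : ∀ p, EST p = output B ε q (fun v => X v p.1) p.2 p.2.1) :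
    MemLp EST 2 (P.prod (coinMeasure n B q)) ∧ ∫ p, EST p ∂(P.prod (coinMeasure n B q)) = g ∧
      ∫ p, ‖EST p - g‖ ^ 2 ∂(P.prod (coinMeasure n B q)) ≤ 18 * ε ^ 2 + 2 * σ ^ 2 := by
  have := hB.isProbabilityMeasure_trial (q := q) hε
  have := hB.isProbabilityMeasure_coin (n := n) (q := q) hε
  have hq0 := hq.out
  have hn : (n : ℝ) ≠ 0 := by exact_mod_cast NeZero.ne n
  let X' : Fin n → Ω → Vec d := fun v => (hX v).1.mk
  have hX' : ∀ v, Measurable (X' v) := fun v => (hX v).1.stronglyMeasurable_mk.measurable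
  let D : Ω × Coins n d q → Vec d := fun p => decodeError B ε q (X' p.2.1 p.1, p.2.2)
  have hDmeas : Measurable D := (hB.measurable_decodeError hε).comp (measurable_select hX')
  have hDle : ∀ p, ‖D p‖ ≤ 3 * ε := fun p => hB.norm_residual_le hε _
  have hDLp : MemLp D 2 (P.prod (coinMeasure n B q)) :=
    MemLp.of_bound hDmeas.aestronglyMeasurable (3 * ε) (Filter.Eventually.of_forall hDle)
  have hDint : Integrable D (P.prod (coinMeasure n B q)) := hDLp.integrable one_le_two
  have hD0 : ∫ p, D p ∂(P.prod (coinMeasure n B q)) = 0 := by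
    rw [integral_prod _ hDint]
    refine (integral_congr_ae (Filter.Eventually.of_forall fun ω => ?_)).trans (integral_zero _ _)
    have hDω : Integrable (fun r => D (ω, r)) (coinMeasure n B q) :=
      Integrable.of_bound (hDmeas.comp measurable_prodMk_left).aestronglyMeasurable (3 * ε)
        (Filter.Eventually.of_forall fun r => hDle _)
    show ∫ r, D (ω, r) ∂(coinMeasure n B q) = 0
    rw [coinMeasure] at hDω ⊢
    rw [integral_prod _ hDω]
    refine (integral_congr_ae (Filter.Eventually.of_forall fun u => ?_)).trans (integral_zero _ _)
    exact hB.integral_decodeError hε hd (X' u ω)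
  have hXLp : MemLp (fun p : Ω × Coins n d q => X p.2.1 p.1) 2 (P.prod (coinMeasure n B q)) :=
    memLp_select hX
  have hae : EST =ᵐ[P.prod (coinMeasure n B q)] (fun p => X p.2.1 p.1) + D := by
    filter_upwards [hB.ae_output_eq hε hd fun v => (hX v).1,
      ae_sourceMeasure fun v => (hX v).1.ae_eq_mk] with p hp hp'
    rw [hEST, hp p.2.1 (by rw [sub_self, norm_zero]; positivity), Pi.add_apply]
    simp only [D, X', ← hp']
  have hLp : MemLp EST 2 (P.prod (coinMeasure n B q)) := (hXLp.add hDLp).ae_eq hae.symm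
  have hsq : ∀ v, Integrable (fun ω => ‖X v ω - g‖ ^ 2) P := fun v =>
    ((hX v).sub (memLp_const g)).integrable_norm_pow two_ne_zero
  refine ⟨hLp, ?_, ?_⟩
  · have hsel := integral_select (P := P) (X := X)
      (ν := Measure.infinitePi fun _ : ℕ => trialMeasure B q)
      fun v => (hX v).integrable one_le_two
    rw [integral_congr_ae hae, integral_add' (hXLp.integrable one_le_two) hDint, hD0, add_zero]
    refine hsel.trans ?_
    simp only [hmean, Finset.sum_const, Finset.card_univ, Fintype.card_fin]
    rw [← Nat.cast_smul_eq_nsmul ℝ, smul_smul, inv_mul_cancel₀ hn, one_smul]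
  · have hsel := integral_select (P := P) (X := fun v ω => ‖X v ω - g‖ ^ 2)
      (ν := Measure.infinitePi fun _ : ℕ => trialMeasure B q) hsq
    have hsel_le : ∫ p, ‖X p.2.1 p.1 - g‖ ^ 2 ∂(P.prod (coinMeasure n B q)) ≤ σ ^ 2 := by
      refine hsel.trans_le ?_
      rw [smul_eq_mul, inv_mul_le_iff₀ (by positivity)]
      refine (Finset.sum_le_sum fun v _ => hvar v).trans_eq ?_
      simp
    have hselint : Integrable (fun p : Ω × Coins n d q => ‖X p.2.1 p.1 - g‖ ^ 2)
        (P.prod (coinMeasure n B q)) :=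
      (hXLp.sub (memLp_const g)).integrable_norm_pow two_ne_zero
    calc ∫ p, ‖EST p - g‖ ^ 2 ∂(P.prod (coinMeasure n B q))
        ≤ ∫ p, (18 * ε ^ 2 + 2 * ‖X p.2.1 p.1 - g‖ ^ 2) ∂(P.prod (coinMeasure n B q)) := by
          refine integral_mono_ae ((hLp.sub (memLp_const g)).integrable_norm_pow two_ne_zero)
            ((integrable_const _).add (hselint.const_mul 2)) ?_
          filter_upwards [hae] with p hp
          have h1 : ‖EST p - g‖ ≤ 3 * ε + ‖X p.2.1 p.1 - g‖ := by
            rw [hp, Pi.add_apply, add_sub_right_comm, add_comm]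
            exact (norm_add_le _ _).trans (by gcongr; exact hDle p)
          have h2 := norm_nonneg (EST p - g)
          have h3 := sq_nonneg (3 * ε - ‖X p.2.1 p.1 - g‖)
          have h4 := pow_le_pow_left₀ h2 h1 2
          show ‖EST p - g‖ ^ 2 ≤ 18 * ε ^ 2 + 2 * ‖X p.2.1 p.1 - g‖ ^ 2
          linarith
      _ = 18 * ε ^ 2 + 2 * ∫ p, ‖X p.2.1 p.1 - g‖ ^ 2 ∂(P.prod (coinMeasure n B q)) := by
          rw [integral_add (integrable_const _) (hselint.const_mul 2), integral_const,
            integral_const_mul, probReal_univ, one_smul]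
      _ ≤ 18 * ε ^ 2 + 2 * σ ^ 2 := by gcongr

end Main

end SublinearVR

theorem mainTheorem11 (Q : ℝ) (hQ : 0 < Q) :
    ∃ C > (0 : ℝ), ∃ c > (0 : ℝ),
      ∀ (n d : ℕ) (α σ q : ℝ), 1 ≤ n → 1 ≤ d → 1 < α → 0 < σ → 0 < q → q ≤ Q →
      ∀ ε : ℝ, ε = 2 * σ * √(α * n) / q →
        (∃ B : Module.Basis (Fin d) ℝ (SublinearVR.Vec d), SublinearVR.IsEpsLattice B ε) ∧
        ∀ B : Module.Basis (Fin d) ℝ (SublinearVR.Vec d), SublinearVR.IsEpsLattice B ε →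
        ∀ (Ω : Type*) [MeasurableSpace Ω] (P : Measure Ω) [IsProbabilityMeasure P]
          (X : Fin n → Ω → SublinearVR.Vec d) (g : SublinearVR.Vec d),
          iIndepFun X P →
          (∀ v, MemLp (X v) 2 P) →
          (∀ v, ∫ ω, X v ω ∂P = g) →
          (∀ v, ∫ ω, ‖X v ω - g‖ ^ 2 ∂P ≤ σ ^ 2) →
          ∀ μ : Measure (Ω × SublinearVR.Coins n d q),
            μ = P.prod (SublinearVR.coinMeasure n B q) →
          ∀ EST : Ω × SublinearVR.Coins n d q → SublinearVR.Vec d,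
            (∀ ω, EST ω = SublinearVR.output B ε q (fun v => X v ω.1) ω.2 ω.2.1) →
          -- the encoding loop terminates almost surely
          (∀ᵐ ω ∂μ, SublinearVR.Terminates B ε q (fun v => X v ω.1) ω.2) ∧
          -- communication
          μ {ω | ∃ v, C * d * q < SublinearVR.bitsUsed B ε q (fun v => X v ω.1) ω.2 v} ≤
            ENNReal.ofReal ((2 : ℝ) ^ ((1 - d * q) * (2 : ℝ) ^ (c * d * q))) ∧
          -- unbiasedness and variance
          MemLp EST 2 μ ∧ ∫ ω, EST ω ∂μ = g ∧
          ∫ ω, ‖EST ω - g‖ ^ 2 ∂μ ≤ C * (α * n * σ ^ 2 / q ^ 2) ∧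
          -- all machines output the same value
          μ {ω | ∃ v, SublinearVR.output B ε q (fun v => X v ω.1) ω.2 v ≠ EST ω} ≤
            ENNReal.ofReal (1 / α) := by
  refine ⟨72 + 2 * Q ^ 2, by positivity, 1, one_pos, ?_⟩
  intro n d α σ q hn hd hα hσ hq hqQ ε hε
  have hn0 : (1 : ℝ) ≤ n := by exact_mod_cast hn
  have hαn : 1 ≤ α * n := by nlinarith
  have hε0 : 0 < ε := by rw [hε]; positivity
  refine ⟨SublinearVR.exists_isEpsLattice hd hε0, ?_⟩
  rintro B hB Ω _ P _ X g - hX hmean hvar _ rfl EST hEST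
  have : Fact (0 < q) := ⟨hq⟩
  have : NeZero n := ⟨by omega⟩
  have hqε : q * ε = 2 * (σ * √(α * n)) := by rw [hε]; field_simp
  have hbits := hB.measure_bitsUsed_le (P := P) (q := q) hε0 hd (fun v => (hX v).1)
    (C := 72 + 2 * Q ^ 2) (by nlinarith [sq_nonneg Q])
  have hagree := hB.measure_output_ne_le hε0 hd hX hσ hα hqε hvar
  obtain ⟨hLp, hint, hsq⟩ := hB.output_source_unbiased hε0 hd hX hmean hvar hEST
  refine ⟨hB.ae_terminates hε0 hd fun v => (hX v).1, by simpa only [one_mul] using hbits, hLp,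
    hint, hsq.trans ?_, by simpa only [hEST] using hagree⟩
  have hε2 : ε ^ 2 = 4 * (α * n * σ ^ 2 / q ^ 2) := by
    rw [hε, div_pow, mul_pow, Real.sq_sqrt (by positivity)]; ring
  have hσ2 : σ ^ 2 ≤ Q ^ 2 * (α * n * σ ^ 2 / q ^ 2) := by
    rw [mul_div_assoc', le_div_iff₀ (by positivity)]
    calc σ ^ 2 * q ^ 2 ≤ σ ^ 2 * Q ^ 2 := by gcongr
      _ ≤ (α * n) * (σ ^ 2 * Q ^ 2) := le_mul_of_one_le_left (by positivity) hαn
      _ = Q ^ 2 * (α * n * σ ^ 2) := by ring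
  rw [hε2]
  linarith
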